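/- **Classical formulas.** Let $L_c$ be the propositional language with symbols $B=\{B_j:j\in\mathbb N\}$, verum $\top$, and connectives $\neg,\to$ (with $\alpha\wedge\beta:=\neg(\alpha\to\neg\beta)$). $B_\alpha$ is the set of symbols occurring in $\alpha$. A symbol $B_j\in B_\alpha$ is *essential* for $\alpha$ if, for some valuation, changing only the value of $B_j$ changes the truth value of $\alpha$; $eB_\alpha$ is the set of essential symbols. For finite $U\subseteq A\subset B$ let $\phi_A^U$ be the formula $\bigl(\bigwedge_{B_j\in U}B_j\bigr)\wedge\bigl(\bigwedge_{B_j\in A\setminus U}\neg B_j\bigr)$ (conjunctions in increasing order of indices, empty conjunctions being $\top$), and $\phi_\emptyset^\emptyset:=\top$. **RCOF.** RCOF is the first-order theory of real closed ordered fields, in the signature with $0,1$, unary $-$, binary $+,\times$, and predicates $=,<$; its theorems are the sentences that hold in all of its models. The variables are $x_k$ ($k\in\mathbb N$), $x_\alpha$ ($\alpha\in L_c$) and $x_{A'}$ ($A'\subset B$, $|A'|=2$). **PLQO formulas.** These are built with $\to$ from the atoms $\mathsf O\alpha$ and $\int\!\alpha\circ p$, where $\alpha\in L_c$, $\circ\in\{=,<\}$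 and $p$ is a term whose variables are among the $x_k$. Abbreviations: $\neg\varphi:=\varphi\to(\int\!\top<1)$ and $\varphi\wedge\psi:=\neg(\varphi\to\neg\psi)$. A literal is an atom or the negation of an atom. **Semantics.** A *quantum structure* $I$ consists of a complex separable Hilbert space $\mathcal H$, a unit vector $\psi\in\mathcal H$ and, for each $j$, a pair $(O_j,T_j)$ with $O_j$ a (possibly unbounded) self-adjoint operator on $\mathcal H$ and $T_j$ a Borel subset of its spectrum. Let $P_j^1=\nu_j(T_j)$ and $P_j^0=1-P_j^1$, where $\nu_j$ is the projection-valued spectral measure of $O_j$. The symbols $B_i,B_j$ are *compatible* in $I$ if $P_i^1$ and $P_j^1$ commute. For $B_\alpha=\{B_{j_1},\dots,B_{j_k}\}$, $j_1<\dots<j_k$, put $$\mathrm{Prob}_I(\alpha)=\sum_{v:B_\alpha\to\{0,1\},\ v\Vdash\alpha}\mathrm{Re}\,\bigl\langle\psi,\,P_{j_k}^{v(B_{j_k})}\cdots P_{j_1}^{v(B_{j_1})}\psi\bigr\rangle .$$ (The real part may be omitted when the symbols in $eB_\alpha$ are pairwise compatible in $I$, the only case in which the number is used.) For an assignment $\rho$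 of real numbers to the variables: * $I\rho\Vdash\mathsf O\alpha$ iff the symbols in $eB_\alpha$ are pairwise compatible in $I$; * $I\rho\Vdash\int\!\alpha\circ p$ iff $I\rho\Vdash\mathsf O\alpha$ and $\mathrm{Prob}_I(\alpha)\circ p^{\mathbb R\rho}$, where $p^{\mathbb R\rho}$ is the value of $p$ in $\mathbb R$ under $\rho$; * $I\rho\Vdash\varphi_1\to\varphi_2$ iff $I\rho\not\Vdash\varphi_1$ or $I\rho\Vdash\varphi_2$. $\varphi$ is *valid* if $I\rho\Vdash\varphi$ for every quantum structure $I$ and every assignment $\rho$. **Calculus.** For finite $A\subset B$ and a finite set $\Delta$ of classical formulas, $Q_{\mathsf O}^A$ is the RCOF formula $\bigwedge_{A'\subseteq A,|A'|=2}x_{A'}=0$, and $Q^{A,\Delta}$ is the conjunction of: * $0\le x_{\phi_A^U}\le1$ for all $U\subseteq A$; * $\sum_{U\subseteq A}x_{\phi_A^U}=1$; * $x_{\phi_{A'}^{U'}}=\sum_{U\subseteq A,\ U\cap A'=U'}x_{\phi_A^U}$ for all $U'\subseteq A'\subseteq A$; * $x_{A'}\ge0$ for all $A'\subseteq A$ with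 $|A'|=2$; * $x_\alpha=\sum_{v:B_\alpha\to\{0,1\},\,v\Vdash\alpha}x_{\phi_{B_\alpha}^{\{B_j\in B_\alpha:\,v(B_j)=1\}}}$ for all $\alpha\in\Delta$. The translation $\varphi\mapsto\varphi^{\mathrm{RCOF}}$ sends $\mathsf O\alpha$ to $Q_{\mathsf O}^{eB_\alpha}$, sends $\int\!\alpha\circ p$ to $Q_{\mathsf O}^{eB_\alpha}\wedge(x_\alpha\circ p)$, and commutes with $\to$. For a PLQO formula $\varphi$, $B_\varphi$ is the set of symbols occurring in $\varphi$ and $\Delta_\varphi$ the set of those $\alpha$ such that some $\int\!\alpha\circ p$ occurs in $\varphi$. The PLQO calculus has the following axioms and rule: * **TT**: every tautological formula, i.e. one that is true for every assignment of truth values to its atoms (atoms being treated as independent propositional variables); * **MP**: from $\varphi_1$ and $\varphi_1\to\varphi_2$ infer $\varphi_2$; * **RR**: every formula $\varphi$ of the form $(\beta_1\wedge\dots\wedge\beta_k)\to\beta$, with $k\ge0$ and literals $\beta_1,\dots,\beta_k,\beta$ (for $k=0$, $\varphi$ is $\beta$), such that the universal closure of $\bigl(Q^{B_\varphi,\Delta_\varphi}\wedge\bigwedge_{j=1}^k\beta_j^{\mathrm{RCOF}}\bigr)\to\beta^{\mathrm{RCOF}}$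 is a theorem of RCOF. **Theorem (weak completeness).** Every valid PLQO formula is derivable in the PLQO calculus (from no hypotheses). -/

import Mathlib

namespace PLQO

/-! ## Classical propositional logic -/

/-- The classical language over the propositional symbols `B 0, B 1, ...`, with verum,
negation and implication as primitives. -/
inductive CForm : Type
  | sym : ℕ → CForm
  | verum : CForm
  | neg : CForm → CForm
  | imp : CForm → CForm → CForm
  deriving DecidableEq

namespace CForm

/-- Conjunction, as an abbreviation. -/
def conj (a b : CForm) : CForm := neg (imp a (neg b))

/-- The set `B_α` of propositional symbols that occur in a formula. -/
def syms : CForm → Finset ℕ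
  | sym j => {j}
  | verum => ∅
  | neg a => a.syms
  | imp a b => a.syms ∪ b.syms

/-- Truth value of a formula under a valuation. -/
def eval (v : ℕ → Bool) : CForm → Bool
  | sym j => v j
  | verum => true
  | neg a => !(a.eval v)
  | imp a b => !(a.eval v) || b.eval v

/-- The valuations `B_α → {0,1}` that satisfy `α`; a valuation on a finite set `A` of symbols is
represented by the subset `U` of `A` where it takes the value `1`. -/
def satVals (a : CForm) : Finset (Finset ℕ) :=
  a.syms.powerset.filter fun U => a.eval (fun j => decide (j ∈ U)) = true

/-- The symbol `B j` is essential for the formula: it occurs, and for some valuation the truth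
value depends on the value given to `B j`. -/
def IsEssential (a : CForm) (j : ℕ) : Prop :=
  j ∈ a.syms ∧ ∃ v : ℕ → Bool,
    (a.eval (Function.update v j false) = true ↔ ¬ a.eval (Function.update v j true) = true)

open Classical in
/-- The set `eB_α` of essential symbols. -/
noncomputable def essSyms (a : CForm) : Finset ℕ := a.syms.filter a.IsEssential

/-- Conjunction of a finite list of formulas (verum for the empty list). -/
def bigConj : List CForm → CForm
  | [] => verum
  | [a] => a
  | a :: b :: l => conj a (bigConj (b :: l))

/-- The formula `φ_A^U` that identifies the valuation on `A` with value `1` exactly on `U`: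
the symbols in `U` and the negations of those in `A \ U`, in increasing order. -/
def valForm (A U : Finset ℕ) : CForm :=
  if A = ∅ then verum
  else conj (bigConj ((U.sort (· ≤ ·)).map sym))
    (bigConj (((A \ U).sort (· ≤ ·)).map fun j => neg (sym j)))

end CForm

/-! ## The first-order theory of real closed ordered fields -/

section RealClosed

open FirstOrder FirstOrder.Language

/-- Function symbols: constants `0`, `1`, unary `-`, binary `+`, `×`. -/
inductive RFunc : ℕ → Type
  | zero : RFunc 0
  | one : RFunc 0
  | neg : RFunc 1
  | add : RFunc 2
  | mul : RFunc 2

/-- Predicate symbols: binary `<` (equality is logical). -/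
inductive RRel : ℕ → Type
  | lt : RRel 2

/-- The first-order signature of real closed ordered fields. -/
def rLang : FirstOrder.Language.{0, 0} := ⟨RFunc, RRel⟩

/-- Terms over the signature. -/
abbrev RTerm (V : Type) : Type := rLang.Term V

section
variable {V : Type}

/-- The constant `0`. -/
def tZero : RTerm V := Constants.term (L := rLang) RFunc.zero
/-- The constant `1`. -/
def tOne : RTerm V := Constants.term (L := rLang) RFunc.one
/-- Negation of a term. -/
def tNeg (t : RTerm V) : RTerm V := Functions.apply₁ (L := rLang) RFunc.neg t
/-- Addition of terms. -/
def tAdd (s t : RTerm V) : RTerm V := Functions.apply₂ (L := rLang) RFunc.add s t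
/-- Multiplication of terms. -/
def tMul (s t : RTerm V) : RTerm V := Functions.apply₂ (L := rLang) RFunc.mul s t

/-- Powers of a term. -/
def tPow (t : RTerm V) : ℕ → RTerm V
  | 0 => tOne
  | n + 1 => tMul (tPow t n) t

/-- Sum of a finite list of terms. -/
def tListSum (l : List (RTerm V)) : RTerm V := l.foldr tAdd tZero

/-- Sum of a finite family of terms. -/
noncomputable def tSum {ι : Type} (s : Finset ι) (f : ι → RTerm V) : RTerm V :=
  tListSum (s.toList.map f)

end

/-- The atomic formula `s < t` (with `n` bound variables in scope). -/
def bLt {V : Type} {n : ℕ} (s t : RTerm (V ⊕ Fin n)) : rLang.BoundedFormula V n :=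
  Relations.boundedFormula₂ (L := rLang) RRel.lt s t

/-- The atomic formula `s < t` on terms without bound variables. -/
def fLt {V : Type} (s t : RTerm V) : rLang.Formula V :=
  Relations.formula₂ (L := rLang) RRel.lt s t

/-- `s ≤ t` as an abbreviation for `s < t ∨ s = t`. -/
def fLe {V : Type} (s t : RTerm V) : rLang.Formula V := fLt s t ⊔ Term.equal s t

/-- The axioms of the theory of real closed ordered fields. -/
inductive RAxiom : Type
  | addAssoc | addComm | zeroAdd | negAdd
  | mulAssoc | mulComm | oneMul | leftDistrib | existsInv | zeroNeOne
  | ltIrrefl | ltTrans | ltTotal | addLt | mulPos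
  | sqrt
  | oddRoot (n : ℕ)

/-- The sentence expressed by each axiom. The axiom `oddRoot n` says that every monic polynomial
`y ^ (2 n + 1) + a (2 n) y ^ (2 n) + ... + a 0` has a root. -/
def RAxiom.toSentence : RAxiom → rLang.Sentence
  | .addAssoc => ∀' ∀' ∀' (tAdd (tAdd (&0) (&1)) (&2) =' tAdd (&0) (tAdd (&1) (&2)))
  | .addComm => ∀' ∀' (tAdd (&0) (&1) =' tAdd (&1) (&0))
  | .zeroAdd => ∀' (tAdd tZero (&0) =' &0)
  | .negAdd => ∀' (tAdd (tNeg (&0)) (&0) =' tZero)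
  | .mulAssoc => ∀' ∀' ∀' (tMul (tMul (&0) (&1)) (&2) =' tMul (&0) (tMul (&1) (&2)))
  | .mulComm => ∀' ∀' (tMul (&0) (&1) =' tMul (&1) (&0))
  | .oneMul => ∀' (tMul tOne (&0) =' &0)
  | .leftDistrib =>
      ∀' ∀' ∀' (tMul (&0) (tAdd (&1) (&2)) =' tAdd (tMul (&0) (&1)) (tMul (&0) (&2)))
  | .existsInv => ∀' (∼(&0 =' tZero) ⟹ ∃' (tMul (&0) (&1) =' tOne))
  | .zeroNeOne => ∼(tZero =' tOne)
  | .ltIrrefl => ∀' ∼(bLt (&0) (&0))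
  | .ltTrans => ∀' ∀' ∀' (bLt (&0) (&1) ⟹ bLt (&1) (&2) ⟹ bLt (&0) (&2))
  | .ltTotal => ∀' ∀' (bLt (&0) (&1) ⊔ ((&0 =' &1) ⊔ bLt (&1) (&0)))
  | .addLt => ∀' ∀' ∀' (bLt (&0) (&1) ⟹ bLt (tAdd (&0) (&2)) (tAdd (&1) (&2)))
  | .mulPos => ∀' ∀' (bLt tZero (&0) ⟹ bLt tZero (&1) ⟹ bLt tZero (tMul (&0) (&1)))
  | .sqrt => ∀' (bLt tZero (&0) ⟹ ∃' (tMul (&1) (&1) =' &0))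
  | .oddRoot n => BoundedFormula.alls (n := 2 * n + 1) (∃'
      (tAdd (tPow (&(Fin.last (2 * n + 1))) (2 * n + 1))
        (tListSum ((List.finRange (2 * n + 1)).map fun (i : Fin (2 * n + 1)) =>
          tMul (&(i.castSucc)) (tPow (&(Fin.last (2 * n + 1))) i))) =' tZero))

/-- The theory of real closed ordered fields. -/
def rcof : rLang.Theory := Set.range RAxiom.toSentence

/-- The standard interpretation of the signature in the real numbers. -/
instance realStructure : rLang.Structure ℝ where
  funMap := fun f =>
    match f with
    | RFunc.zero => fun _ => 0
    | RFunc.one => fun _ => 1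
    | RFunc.neg => fun x => -(x 0)
    | RFunc.add => fun x => x 0 + x 1
    | RFunc.mul => fun x => x 0 * x 1
  RelMap := fun r =>
    match r with
    | RRel.lt => fun x => x 0 < x 1

/-- The variables: `x_k` for natural `k`, `x_α` for classical formulas `α`, and `x_{A'}` for
two-element sets `A'` of propositional symbols. -/
inductive Var : Type
  | num : ℕ → Var
  | form : CForm → Var
  | pair : {A : Finset ℕ // A.card = 2} → Var

/-- The universal closure of the formula `f` is a theorem of real closed ordered fields:
`f` holds in all models of the theory, for all values of its free variables. -/
def IsRcofTheorem (f : rLang.Formula Var) : Prop := rcof ⊨ᵇ f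

/-- The variable `x_α` as a term. -/
def xForm (a : CForm) : RTerm Var := Term.var (Var.form a)

/-- The variable `x_{A'}` as a term, for a two-element subset `A'` of `A`. -/
def xPair {A : Finset ℕ} (A' : A.powersetCard 2) : RTerm Var :=
  Term.var (Var.pair ⟨A'.1, (Finset.mem_powersetCard.1 A'.2).2⟩)

/-- The formula `Q_O^A`: `x_{A'} = 0` for all two-element subsets `A'` of `A`. -/
noncomputable def qObs (A : Finset ℕ) : rLang.Formula Var :=
  Formula.iInf fun A' : A.powersetCard 2 => Term.equal (xPair A') tZero

/-- The formula `Q^{A,Δ}`. -/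
noncomputable def qForm (A : Finset ℕ) (D : Finset CForm) : rLang.Formula Var :=
  (Formula.iInf fun U : A.powerset =>
      fLe tZero (xForm (CForm.valForm A U)) ⊓ fLe (xForm (CForm.valForm A U)) tOne) ⊓
  (Term.equal (tSum A.powerset fun U => xForm (CForm.valForm A U)) tOne ⊓
  ((Formula.iInf fun A' : A.powerset => Formula.iInf fun U' : A'.1.powerset =>
      Term.equal (xForm (CForm.valForm A' U'))
        (tSum (A.powerset.filter fun U => U ∩ A'.1 = U'.1)
          fun U => xForm (CForm.valForm A U))) ⊓
  ((Formula.iInf fun A' : A.powersetCard 2 => fLe tZero (xPair A')) ⊓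
  (Formula.iInf fun a : D =>
      Term.equal (xForm a)
        (tSum a.1.satVals fun U => xForm (CForm.valForm a.1.syms U))))))

end RealClosed

/-! ## The language of the logic -/

/-- The comparison symbols `=` and `<`. -/
inductive Cmp : Type
  | eq
  | lt

/-- Formulas: `obs a` says that `a` is observable, `prob a c p` compares the probability of `a`
with the term `p`, whose variables are among the `x_k`. -/
inductive PForm : Type
  | obs : CForm → PForm
  | prob : CForm → Cmp → RTerm ℕ → PForm
  | imp : PForm → PForm → PForm

namespace PForm

open FirstOrder FirstOrder.Language

/-- The formula `∫ ⊤ < 1`, which plays the role of falsum. -/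
def falsum : PForm := prob CForm.verum Cmp.lt tOne

/-- Negation, as an abbreviation. -/
def neg (f : PForm) : PForm := imp f falsum

/-- Conjunction, as an abbreviation. -/
def conj (f g : PForm) : PForm := neg (imp f (neg g))

/-- `(β₁ ∧ ... ∧ βₖ) → β`, which is just `β` for `k = 0`. -/
def clause : List PForm → PForm → PForm
  | [], g => g
  | f :: l, g => imp (l.foldl conj f) g

/-- Atomic formulas. -/
inductive IsAtom : PForm → Prop
  | obs (a : CForm) : IsAtom (obs a)
  | prob (a : CForm) (c : Cmp) (p : RTerm ℕ) : IsAtom (prob a c p)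

/-- Literals: atomic formulas and their negations. -/
def IsLiteral (f : PForm) : Prop := f.IsAtom ∨ ∃ g, g.IsAtom ∧ f = neg g

/-- The set `B_φ` of propositional symbols that occur in a formula. -/
def syms : PForm → Finset ℕ
  | obs a => a.syms
  | prob a _ _ => a.syms
  | imp f g => f.syms ∪ g.syms

/-- The set of the classical formulas `α` such that some `∫ α ∘ p` occurs in the formula. -/
def probArgs : PForm → Finset CForm
  | obs _ => ∅
  | prob a _ _ => {a}
  | imp f g => f.probArgs ∪ g.probArgs

/-- The translation of formulas into first-order formulas. -/
noncomputable def toRcof : PForm → rLang.Formula Var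
  | obs a => qObs a.essSyms
  | prob a Cmp.eq p => qObs a.essSyms ⊓ Term.equal (xForm a) (p.relabel Var.num)
  | prob a Cmp.lt p => qObs a.essSyms ⊓ fLt (xForm a) (p.relabel Var.num)
  | imp f g => f.toRcof.imp g.toRcof

/-- Truth value of a formula when its atomic formulas are given arbitrary truth values. -/
def propEval (e : PForm → Prop) : PForm → Prop
  | obs a => e (obs a)
  | prob a c p => e (prob a c p)
  | imp f g => f.propEval e → g.propEval e

/-- Tautological formulas: true for every assignment of truth values to the atomic formulas. -/
def IsTautological (f : PForm) : Prop := ∀ e : PForm → Prop, f.propEval e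

/-- The first-order formula whose universal closure has to be a theorem for the axiom `RR`. -/
noncomputable def rrCondition (bs : List PForm) (b : PForm) : rLang.Formula Var :=
  (qForm (clause bs b).syms (clause bs b).probArgs ⊓
    (bs.map toRcof).foldr (· ⊓ ·) ⊤).imp b.toRcof

/-- Derivability in the calculus, from no hypotheses. -/
inductive Derivable : PForm → Prop
  | TT (f : PForm) : f.IsTautological → Derivable f
  | MP (f g : PForm) : Derivable f → Derivable (imp f g) → Derivable g
  | RR (bs : List PForm) (b : PForm) : (∀ f ∈ bs, f.IsLiteral) → b.IsLiteral →
      IsRcofTheorem (rrCondition bs b) → Derivable (clause bs b)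

end PForm

/-! ## Quantum structures -/

section Quantum

open MeasureTheory
open scoped InnerProductSpace

variable {H : Type} [NormedAddCommGroup H] [InnerProductSpace ℂ H] [CompleteSpace H]

variable (H) in
/-- Projection-valued measures on a measurable space `Ω`, with values in the orthogonal
projections of `H` (the values on nonmeasurable sets are irrelevant). -/
structure PVM (Ω : Type) [MeasurableSpace Ω] where
  /-- The projection assigned to a measurable set. -/
  proj : Set Ω → H →L[ℂ] H
  isStarProjection : ∀ S, MeasurableSet S → IsStarProjection (proj S)
  proj_empty : proj ∅ = 0
  proj_univ : proj Set.univ = 1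
  proj_iUnion : ∀ S : ℕ → Set Ω, (∀ j, MeasurableSet (S j)) →
    Pairwise (Function.onFun Disjoint S) →
    ∀ ξ : H, HasSum (fun j => proj (S j) ξ) (proj (⋃ j, S j) ξ)
  proj_inter : ∀ S T, MeasurableSet S → MeasurableSet T → proj (S ∩ T) = proj S * proj T

theorem PVM.inner_eq_norm_sq {Ω : Type} [MeasurableSpace Ω] (ν : PVM H Ω) {S : Set Ω}
    (hS : MeasurableSet S) (ξ : H) : (⟪ξ, ν.proj S ξ⟫_ℂ).re = ‖ν.proj S ξ‖ ^ 2 := by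
  have h := ν.isStarProjection S hS
  have h1 : ν.proj S ξ = ν.proj S (ν.proj S ξ) := by
    have := congrArg (fun T : H →L[ℂ] H => T ξ) h.isIdempotentElem.eq
    exact this.symm
  have h2 : ⟪ξ, ν.proj S (ν.proj S ξ)⟫_ℂ = ⟪ν.proj S ξ, ν.proj S ξ⟫_ℂ :=
    (h.isSelfAdjoint.isSymmetric ξ (ν.proj S ξ)).symm
  rw [h1, h2, ← h1]
  simpa using (inner_self_eq_norm_sq (𝕜 := ℂ) (ν.proj S ξ))

/-- The finite measure `S ↦ ⟨ξ, ν(S) ξ⟩`. -/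
noncomputable def PVM.measure {Ω : Type} [MeasurableSpace Ω] (ν : PVM H Ω) (ξ : H) :
    Measure Ω :=
  Measure.ofMeasurable (fun S _ => ENNReal.ofReal (⟪ξ, ν.proj S ξ⟫_ℂ).re)
    (by simp [ν.proj_empty])
    (by
      intro S hS hd
      have h1 := ν.proj_iUnion S hS hd ξ
      have h2 : HasSum (fun j => (⟪ξ, ν.proj (S j) ξ⟫_ℂ).re)
          (⟪ξ, ν.proj (⋃ j, S j) ξ⟫_ℂ).re :=
        Complex.hasSum_re (h1.mapL (innerSL ℂ ξ))
      have h3 : ∀ j, 0 ≤ (⟪ξ, ν.proj (S j) ξ⟫_ℂ).re := fun j => by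
        rw [ν.inner_eq_norm_sq (hS j)]; positivity
      rw [← h2.tsum_eq, ENNReal.ofReal_tsum_of_nonneg h3 h2.summable])

/-- The (real) spectrum of a possibly unbounded operator. For a self-adjoint operator the
spectrum is real, and `A - λ` is bijective from the domain onto `H` iff it has a bounded inverse
(closed graph theorem). -/
def realSpectrum (A : H →ₗ.[ℂ] H) : Set ℝ :=
  {r | ¬ Function.Bijective fun x : A.domain => A x - (r : ℂ) • (x : H)}

/-- `ν` is the spectral measure of `A`, that is, `A = ∫ ω dν(ω)`: the domain of `A` consists of
the vectors `ξ` such that `ω ↦ ω ^ 2` is integrable for `⟨ξ, ν(·) ξ⟩`, and there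
`⟨ξ, A ξ⟩ = ∫ ω d⟨ξ, ν(ω) ξ⟩`. -/
structure IsSpectralMeasure (A : H →ₗ.[ℂ] H) (ν : PVM H (realSpectrum A)) : Prop where
  mem_domain_iff : ∀ ξ : H, ξ ∈ A.domain ↔
    ∫⁻ ω, ENNReal.ofReal ((ω : ℝ) ^ 2) ∂(ν.measure ξ) < ⊤
  inner_apply : ∀ ξ : A.domain,
    ⟪(ξ : H), A ξ⟫_ℂ = ((∫ ω, (ω : ℝ) ∂(ν.measure (ξ : H)) : ℝ) : ℂ)

variable (H) in
/-- Propositional quantum variables: a self-adjoint operator together with a Borel subset `up` of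
its spectrum. The spectral measure is determined by the operator, and it is recorded here because
the semantics refers to it. -/
structure PQV where
  /-- The observable. -/
  op : H →ₗ.[ℂ] H
  isSelfAdjoint : IsSelfAdjoint op
  /-- The spectral measure of the observable. -/
  spectral : PVM H (realSpectrum op)
  isSpectralMeasure : IsSpectralMeasure op spectral
  /-- The distinguished spectral values. -/
  up : Set (realSpectrum op)
  measurableSet_up : MeasurableSet up

/-- The projection for the outcome "true" (distinguished values) or "false" (their complement). -/
def PQV.proj (Y : PQV H) (b : Bool) : H →L[ℂ] H :=
  Y.spectral.proj (if b then Y.up else Y.upᶜ)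

/-- Compatibility: the projections onto the distinguished spectral subspaces commute. -/
def PQV.Compatible (Y Z : PQV H) : Prop := Commute (Y.proj true) (Z.proj true)

variable (H) in
/-- Quantum structures on the Hilbert space `H`: a unit vector and an interpretation of the
propositional symbols as propositional quantum variables. -/
structure QStructure where
  /-- The quantum state. -/
  state : H
  norm_state : ‖state‖ = 1
  /-- The interpretation of the propositional symbols. -/
  var : ℕ → PQV H

namespace QStructure

open FirstOrder FirstOrder.Language

/-- The probability `⟨ψ, P_{j_k} ⋯ P_{j_1} ψ⟩` of the joint outcome on the symbols
`A = {j_1 < ... < j_k}` given by the valuation with value `1` exactly on `U`. (The number is real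
when the symbols are interpreted by pairwise compatible variables.) -/
noncomputable def jointProb (I : QStructure H) (A U : Finset ℕ) : ℝ :=
  (⟪I.state,
    (((A.sort (· ≤ ·)).reverse.map fun j => (I.var j).proj (decide (j ∈ U))).prod) I.state⟫_ℂ).re

/-- The probability of a classical formula: the sum of the joint probabilities over the
valuations on its symbols that satisfy it. -/
noncomputable def formProb (I : QStructure H) (a : CForm) : ℝ :=
  ∑ U ∈ a.satVals, I.jointProb a.syms U

/-- Observability: the essential symbols are interpreted by pairwise compatible variables. -/
def Observable (I : QStructure H) (a : CForm) : Prop :=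
  ∀ i ∈ a.essSyms, ∀ j ∈ a.essSyms, (I.var i).Compatible (I.var j)

/-- Satisfaction of a formula by a quantum structure and an assignment. -/
def Sat (I : QStructure H) (ρ : Var → ℝ) : PForm → Prop
  | .obs a => I.Observable a
  | .prob a .eq p => I.Observable a ∧ I.formProb a = (p.relabel Var.num).realize ρ
  | .prob a .lt p => I.Observable a ∧ I.formProb a < (p.relabel Var.num).realize ρ
  | .imp f g => ¬ I.Sat ρ f ∨ I.Sat ρ g

end QStructure

/-- Validity: satisfaction by every quantum structure (on any complex separable Hilbert space)
and every assignment. -/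
def Valid (f : PForm) : Prop :=
  ∀ (H : Type) [NormedAddCommGroup H] [InnerProductSpace ℂ H] [CompleteSpace H]
    [TopologicalSpace.SeparableSpace H] (I : QStructure H) (ρ : Var → ℝ), I.Sat ρ f

end Quantum

end PLQO

set_option linter.unusedSectionVars false

namespace PLQO

/-! ### Polynomials over real closed fields: irreducibles, intermediate values, Rolle. -/

section RealClosedField

open Polynomial

variable {K : Type} [Field K]

/-! The propositional part of the calculus reduces completeness to clauses. If φ is valid, then for
every assignment to its atoms that makes φ false, with falsum false, the corresponding literals
cannot hold together in a quantum structure, so the clause from these literals to falsum is valid.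
Falsum is itself an atom, so assignments that make it true must be handled as well; the clauses from
falsum to each atom of φ do this. Together these finitely many clauses entail φ tautologically
(`derivable_of_valid`).

It remains to see that every valid clause of literals is an instance of RR
(`isRcofTheorem_rrCondition_of_valid`). This has two ingredients.

The first is Tarski transfer. The RCOF condition of a clause is quantifier-free, so it suffices to
check it in ℝ (`isRcofTheorem_of_forall_real`): its truth at a point depends only on the signs of
finitely many integer polynomials there, and any such sign pattern attained in a real closed field
is attained in every other (`exists_sign_aeval_eq`). The induction is on the number of variables.
For one variable, sign tables are built after Cohen, Hörmander and Muchnik: a family is enlarged by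
derivatives and pseudo-remainders, and the signs of finitely many coefficient expressions then
determine the table (`exists_determines`). The real closed fields enter through the intermediate
value property and Rolle's theorem, which rest on Artin's argument that irreducible polynomials have
degree at most 2.

The second is a model construction. A real solution of Q^{A,Δ} gives a probability distribution on
the valuations of A, together with a set of pairs whose variables are nonzero.
`exists_quantum_structure` realizes both in finite dimension: the state lives on blocks where all
the projections are the scalars 0 or 1, one block for each valuation, and incompatibilities are
created on further blocks where the state vanishes. Probabilities and compatibility can thus be
prescribed independently. By the marginal equations of Q^{A,Δ}, the structure satisfies exactly the
formulas over A and Δ whose translations hold at the solution (`exists_structure_of_realize_qForm`),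
so validity of the clause yields its RCOF condition over ℝ. -/

theorem finrank_eq_one_of_odd [IsRealClosed K] [CharZero K] {F : Type} [Field F] [Algebra K F]
    [FiniteDimensional K F] (h : Odd (Module.finrank K F)) : Module.finrank K F = 1 := by
  obtain ⟨α, hα⟩ := Field.exists_primitive_element K F
  have hi : IsIntegral K α := IsIntegral.of_finite K α
  have hd : (minpoly K α).natDegree = Module.finrank K F := by
    rw [← IntermediateField.adjoin.finrank hi, hα, IntermediateField.finrank_top']
  obtain ⟨x, hx⟩ := IsRealClosed.exists_isRoot_of_odd_natDegree (hd ▸ h)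
  rw [← hd]
  exact natDegree_eq_of_degree_eq_some
    (degree_eq_one_of_irreducible_of_root (minpoly.irreducible hi) hx)

/-- The fixed field of a Sylow 2-subgroup has odd degree over K, namely the index of the subgroup,
so it is K itself and the Galois group is a 2-group. -/
theorem exists_finrank_eq_two_pow [IsRealClosed K] [CharZero K] {E : Type} [Field E] [Algebra K E]
    [FiniteDimensional K E] [IsGalois K E] : ∃ n, Module.finrank K E = 2 ^ n := by
  have : Fact (Nat.Prime 2) := ⟨Nat.prime_two⟩
  let P : Sylow 2 Gal(E/K) := default
  have h1 := IntermediateField.finrank_fixedField_eq_card (P : Subgroup Gal(E/K))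
  have h2 := Module.finrank_mul_finrank K (IntermediateField.fixedField (P : Subgroup Gal(E/K))) E
  have h3 := P.1.card_mul_index
  have h4 := P.not_dvd_index
  have hG := IsGalois.card_aut_eq_finrank K E
  rw [hG] at h3
  have hpos : 0 < Nat.card P := Nat.card_pos
  have h5 : Module.finrank K (IntermediateField.fixedField (P : Subgroup Gal(E/K)))
      = (P : Subgroup Gal(E/K)).index := by
    rw [← h3, h1, mul_comm] at h2
    exact Nat.eq_of_mul_eq_mul_left hpos h2
  have h6 := finrank_eq_one_of_odd (K := K)
    (F := IntermediateField.fixedField (P : Subgroup Gal(E/K)))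
    (by rw [h5, ← Nat.not_even_iff_odd, even_iff_two_dvd]; exact h4)
  refine ⟨(Nat.card Gal(E/K)).factorization 2, ?_⟩
  rw [← h2, h6, h1, one_mul, P.card_eq_multiplicity]

/-- A nontrivial 2-group has a subgroup of index 2, whose fixed field is quadratic over F. But
quadratic polynomials have roots in F, since all discriminants are squares. -/
theorem finrank_eq_one_of_isSquare {F E : Type} [Field F] [CharZero F] [Field E] [Algebra F E]
    [FiniteDimensional F E] [IsGalois F E] (hsq : ∀ x : F, IsSquare x) {n : ℕ}
    (hn : Module.finrank F E = 2 ^ n) : Module.finrank F E = 1 := by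
  have : Fact (Nat.Prime 2) := ⟨Nat.prime_two⟩
  rcases n with _ | n
  · simpa using hn
  exfalso
  obtain ⟨N, hN⟩ := Sylow.exists_subgroup_card_pow_prime (G := Gal(E/F)) 2 (n := n)
    (by rw [IsGalois.card_aut_eq_finrank, hn]; exact pow_dvd_pow 2 n.le_succ)
  set Q := IntermediateField.fixedField N with hQ
  have h1 : Module.finrank Q E = 2 ^ n := by
    rw [← hN]; exact IntermediateField.finrank_fixedField_eq_card N
  have h2 := Module.finrank_mul_finrank F Q E
  have h3 : Module.finrank F Q = 2 := by
    rw [h1, hn, pow_succ, mul_comm] at h2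
    exact Nat.eq_of_mul_eq_mul_left (by positivity) h2
  have hbot : Q ≠ ⊥ := fun h => by
    rw [← IntermediateField.finrank_eq_one_iff, h3] at h; omega
  obtain ⟨α, hαQ, hα⟩ : ∃ α ∈ Q, α ∉ (⊥ : IntermediateField F E) := by
    by_contra! h
    exact hbot (le_bot_iff.1 h)
  have hi : IsIntegral F (⟨α, hαQ⟩ : Q) := IsIntegral.of_finite F _
  have hirr := minpoly.irreducible hi
  have hnr : ∀ x : F, ¬ (minpoly F (⟨α, hαQ⟩ : Q)).IsRoot x := by
    intro x hx
    have hdeg := degree_eq_one_of_irreducible_of_root hirr hx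
    obtain ⟨y, hy⟩ := minpoly.mem_range_of_degree_eq_one F _ hdeg
    exact hα (IntermediateField.mem_bot.2 ⟨y, congrArg Subtype.val hy⟩)
  have hle : (minpoly F (⟨α, hαQ⟩ : Q)).natDegree ≤ 2 := h3 ▸ minpoly.natDegree_le _
  have hne1 : (minpoly F (⟨α, hαQ⟩ : Q)).natDegree ≠ 1 := by
    intro h
    obtain ⟨x, hx⟩ := exists_root_of_degree_eq_one
      ((degree_eq_iff_natDegree_eq_of_pos one_pos).2 h)
    exact hnr x hx
  have h0 := minpoly.natDegree_pos hi
  have hd2 : (minpoly F (⟨α, hαQ⟩ : Q)).natDegree = 2 := by omega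
  have hmon := minpoly.monic hi
  generalize minpoly F (⟨α, hαQ⟩ : Q) = g at *
  have hform : g = C 1 * X ^ 2 + C (g.coeff 1) * X + C (g.coeff 0) := by
    have := g.as_sum_range_C_mul_X_pow
    rw [hd2, Finset.sum_range_succ, Finset.sum_range_succ, Finset.sum_range_one] at this
    have hl : g.coeff 2 = 1 := by rw [← hd2]; exact hmon
    rw [hl] at this
    conv_lhs => rw [this]
    ring_nf
  obtain ⟨x, hx⟩ := exists_quadratic_eq_zero (a := (1 : F)) (b := g.coeff 1) (c := g.coeff 0)
    one_ne_zero (hsq _)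
  refine hnr x ?_
  rw [IsRoot, hform]
  simpa [sq] using hx

variable [LinearOrder K] [IsStrictOrderedRing K] [IsRealClosed K]

/-- The usual formula for complex square roots: with n the modulus, the parts are the roots of (n +
a)/2 and (n − a)/2, with signs chosen so that twice their product is b. -/
theorem isSquare_add_mul_of_sq_eq_neg_one {F : Type} [Field F] [Algebra K F] {i : F}
    (hi : i ^ 2 = -1) (a b : K) : IsSquare (algebraMap K F a + algebraMap K F b * i) := by
  obtain ⟨n, hn0, hn⟩ : ∃ n : K, 0 ≤ n ∧ n ^ 2 = a ^ 2 + b ^ 2 := by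
    obtain ⟨r, hr⟩ := IsSquare.of_nonneg (show 0 ≤ a ^ 2 + b ^ 2 by positivity)
    exact ⟨|r|, abs_nonneg r, by rw [sq_abs, hr, sq]⟩
  have hna : |a| ≤ n := abs_le_of_sq_le_sq (by nlinarith [sq_nonneg b]) hn0
  obtain ⟨ha1, ha2⟩ := abs_le.1 hna
  obtain ⟨x, hx⟩ := IsSquare.of_nonneg (show 0 ≤ (n + a) / 2 by linarith)
  obtain ⟨y, hy⟩ := IsSquare.of_nonneg (show 0 ≤ (n - a) / 2 by linarith)
  have hxy : (2 * (x * y)) ^ 2 = b ^ 2 := by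
    have : (2 * (x * y)) ^ 2 = 4 * ((x * x) * (y * y)) := by ring
    rw [this, ← hx, ← hy]
    linear_combination hn
  have key : ∀ s t : K, s * s = (n + a) / 2 → t * t = (n - a) / 2 → 2 * (s * t) = b →
      IsSquare (algebraMap K F a + algebraMap K F b * i) := by
    intro s t hs ht hst
    refine ⟨algebraMap K F s + algebraMap K F t * i, ?_⟩
    have h1 : a = s * s - t * t := by rw [hs, ht]; ring
    rw [h1, ← hst]
    simp only [map_sub, map_mul, map_ofNat]
    linear_combination (-(algebraMap K F t) ^ 2) * hi
  rcases sq_eq_sq_iff_eq_or_eq_neg.1 hxy with h | h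
  · exact key x y hx.symm hy.symm h
  · exact key x (-y) hx.symm (by rw [neg_mul_neg, hy]) (by linear_combination -h)

/-- Artin's proof of the fundamental theorem of algebra: the splitting field has 2-power degree over
K, and K(i) has no proper Galois extension of 2-power degree because all its elements are squares.
Hence the splitting field is K(i), of degree at most 2. -/
theorem natDegree_le_two_of_irreducible {f : K[X]} (hf : Irreducible f) : f.natDegree ≤ 2 := by
  have : CharZero K := inferInstance
  -- The extra factor puts a square root of −1 into the splitting field.
  let g : K[X] := f * (X ^ 2 + 1)
  let E := SplittingField g
  have hX : (X ^ 2 + 1 : K[X]) ≠ 0 := by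
    have : (X ^ 2 + 1 : K[X]) = X ^ 2 + C 1 := by simp
    rw [this]; exact (monic_X_pow_add_C 1 two_ne_zero).ne_zero
  have hg : g ≠ 0 := mul_ne_zero hf.ne_zero hX
  have hsplit := SplittingField.splits g
  have hgal : IsGalois K E := { }
  rw [Polynomial.map_mul] at hsplit
  have hg' : (f.map (algebraMap K E)) * ((X ^ 2 + 1 : K[X]).map (algebraMap K E)) ≠ 0 := by
    rw [← Polynomial.map_mul]; exact (Polynomial.map_ne_zero_iff (algebraMap K E).injective).2 hg
  have hs1 := hsplit.of_dvd hg' (dvd_mul_right _ _)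
  have hs2 := hsplit.of_dvd hg' (dvd_mul_left _ _)
  obtain ⟨α, hα⟩ := hs1.exists_eval_eq_zero (by
    rw [degree_map]; exact (degree_pos_of_irreducible hf).ne')
  obtain ⟨i, hi⟩ := hs2.exists_eval_eq_zero (by
    rw [degree_map, show (X ^ 2 + 1 : K[X]) = X ^ 2 + C 1 by simp, degree_X_pow_add_C two_pos]
    decide)
  replace hi : i ^ 2 = -1 := by
    simp at hi
    linear_combination hi
  let F := IntermediateField.adjoin K {i}
  have hiI : IsIntegral K i := IsIntegral.of_finite K i
  let iF : F := ⟨i, IntermediateField.mem_adjoin_simple_self K i⟩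
  have hiF : iF ^ 2 = -1 := Subtype.ext (by simpa using hi)
  have hF2 : Module.finrank K F ≤ 2 := by
    rw [IntermediateField.adjoin.finrank hiI]
    have : minpoly K i ∣ X ^ 2 + C 1 := minpoly.dvd K i (by simp [hi])
    exact (natDegree_le_of_dvd this (by simpa using hX)).trans (by compute_degree)
  have hsq : ∀ x : F, IsSquare x := by
    intro x
    have hx : (x : E) ∈ Algebra.adjoin K {i} := by
      rw [← IntermediateField.adjoin_simple_toSubalgebra_of_isAlgebraic hiI.isAlgebraic]
      exact x.2
    obtain ⟨a, b, hab⟩ : ∃ a b : K, (x : E) = algebraMap K E a + algebraMap K E b * i := by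
      generalize (x : E) = y at hx
      induction hx using Algebra.adjoin_induction with
      | mem y hy => exact ⟨0, 1, by simpa using hy⟩
      | algebraMap r => exact ⟨r, 0, by rw [map_zero, zero_mul, add_zero]⟩
      | add y z _ _ hy hz =>
        obtain ⟨a, b, h⟩ := hy
        obtain ⟨c, d, h'⟩ := hz
        exact ⟨a + c, b + d, by rw [h, h', map_add, map_add]; ring⟩
      | mul y z _ _ hy hz =>
        obtain ⟨a, b, h⟩ := hy
        obtain ⟨c, d, h'⟩ := hz
        refine ⟨a * c - b * d, a * d + b * c, ?_⟩
        rw [h, h']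
        simp only [map_add, map_sub, map_mul]
        linear_combination (algebraMap K E b * algebraMap K E d) * hi
    have : x = algebraMap K F a + algebraMap K F b * iF := Subtype.ext hab
    rw [this]
    exact isSquare_add_mul_of_sq_eq_neg_one hiF a b
  obtain ⟨n, hn⟩ := exists_finrank_eq_two_pow (K := K) (E := E)
  have hmul := Module.finrank_mul_finrank K F E
  obtain ⟨m, -, hm⟩ := (Nat.dvd_prime_pow Nat.prime_two).1 (hn ▸ Dvd.intro_left _ hmul)
  have h1 := finrank_eq_one_of_isSquare (F := F) (E := E) hsq hm
  have hE : Module.finrank K E ≤ 2 := by rw [← hmul, h1, mul_one]; exact hF2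
  have hroot : aeval α f = 0 := by rwa [aeval_def, eval₂_eq_eval_map]
  have hdvd := (minpoly.irreducible (IsIntegral.of_finite K α)).dvd_symm hf (minpoly.dvd K α hroot)
  exact (natDegree_le_of_dvd hdvd (minpoly.ne_zero (IsIntegral.of_finite K α))).trans
    ((minpoly.natDegree_le (A := K) α).trans hE)

/-- A product that changes sign has an irreducible factor that changes sign. Such a factor is not
quadratic, since an irreducible quadratic has negative discriminant and constant sign; it is linear,
with its root in between. -/
theorem exists_root_of_mul_neg {f : K[X]} {a b : K} (hab : a < b) (h : f.eval a * f.eval b < 0) :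
    ∃ c, a < c ∧ c < b ∧ f.eval c = 0 := by
  induction f using WfDvdMonoid.induction_on_irreducible with
  | zero => simp at h
  | unit u hu =>
    obtain ⟨c, -, rfl⟩ := Polynomial.isUnit_iff.1 hu
    rw [eval_C, eval_C] at h
    exact absurd h (not_lt.2 (mul_self_nonneg c))
  | mul f g _ hg ih =>
    by_cases hf : f.eval a * f.eval b < 0
    · obtain ⟨c, h1, h2, h3⟩ := ih hf
      exact ⟨c, h1, h2, by rw [eval_mul, h3, mul_zero]⟩
    replace h : g.eval a * g.eval b < 0 := by
      rw [eval_mul, eval_mul] at h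
      by_contra h'
      have := mul_nonneg (not_lt.1 h') (not_lt.1 hf)
      linarith
    have hdeg := natDegree_le_two_of_irreducible hg
    have hpos := hg.natDegree_pos
    have hform : ∀ x, g.eval x = g.coeff 2 * x ^ 2 + g.coeff 1 * x + g.coeff 0 := by
      intro x
      rw [eval_eq_sum_range' (show g.natDegree < 3 by omega)]
      simp [Finset.sum_range_succ]
      ring
    by_cases hm : g.coeff 2 = 0
    · have hn : g.coeff 1 ≠ 0 := by
        intro hn
        rw [hform, hform, hm, hn] at h
        nlinarith [mul_self_nonneg (g.coeff 0)]
      set m := g.coeff 1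
      have hc : ∀ x, g.eval x = m * (x - -g.coeff 0 / m) := by
        intro x; rw [hform, hm]; field_simp; ring
      set c := -g.coeff 0 / m
      have hcc : (a - c) * (b - c) < 0 := by
        rw [hc, hc] at h
        have h2 : 0 < m ^ 2 := by positivity
        by_contra h'
        nlinarith [mul_nonneg h2.le (not_lt.1 h')]
      refine ⟨c, ?_, ?_, ?_⟩
      · by_contra h'
        have := mul_nonneg (sub_nonneg.2 (not_lt.1 h')) (sub_nonneg.2 ((not_lt.1 h').trans hab.le))
        linarith
      · by_contra h'
        have := mul_nonneg_of_nonpos_of_nonpos (sub_nonpos.2 (hab.le.trans (not_lt.1 h')))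
          (sub_nonpos.2 (not_lt.1 h'))
        linarith
      · rw [eval_mul, hc, sub_self, mul_zero, zero_mul]
    · exfalso
      have hd2 : g.natDegree = 2 := le_antisymm hdeg (le_natDegree_of_ne_zero hm)
      have hnr : ∀ x, g.eval x ≠ 0 := by
        intro x hx
        have h1 : g.natDegree = 1 :=
          natDegree_eq_of_degree_eq_some (degree_eq_one_of_irreducible_of_root hg hx)
        omega
      have hdisc : discrim (g.coeff 2) (g.coeff 1) (g.coeff 0) < 0 := by
        by_contra h'
        obtain ⟨x, hx⟩ := exists_quadratic_eq_zero hm (IsSquare.of_nonneg (not_lt.1 h'))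
        exact hnr x (by rw [hform, ← hx]; ring)
      rw [discrim] at hdisc
      have hp : ∀ x, 0 < g.coeff 2 * g.eval x := by
        intro x
        have : 4 * (g.coeff 2 * g.eval x) = (2 * g.coeff 2 * x + g.coeff 1) ^ 2
            - (g.coeff 1 ^ 2 - 4 * g.coeff 2 * g.coeff 0) := by rw [hform]; ring
        nlinarith [sq_nonneg (2 * g.coeff 2 * x + g.coeff 1)]
      have h1 := mul_pos (hp a) (hp b)
      have h2 : 0 < g.coeff 2 ^ 2 := by positivity
      nlinarith

theorem mul_eval_pos_of_forall_ne {f : K[X]} {a b : K} (hab : a ≤ b)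
    (h : ∀ c, a ≤ c → c ≤ b → f.eval c ≠ 0) : 0 < f.eval a * f.eval b := by
  have h1 := h a le_rfl hab
  have h2 := h b hab le_rfl
  rcases hab.eq_or_lt with rfl | hlt
  · exact mul_self_pos.2 h1
  rcases (mul_ne_zero h1 h2).lt_or_gt with h3 | h3
  · obtain ⟨c, hc1, hc2, hc3⟩ := exists_root_of_mul_neg hlt h3
    exact absurd hc3 (h c hc1.le hc2.le)
  · exact h3

/-- Splitting off the full powers of X − a and X − b leaves a factor q of constant sign on [a, b].
The derivative is the product of powers of X − a and X − b with a polynomial g whose values at a and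
b are multiples of q(a) and q(b) by factors of opposite sign, so g has a root in between. -/
theorem exists_derivative_root_of_consecutive {f : K[X]} {a b : K} (hab : a < b) (hf : f ≠ 0)
    (ha : f.eval a = 0) (hb : f.eval b = 0) (hno : ∀ c, a < c → c < b → f.eval c ≠ 0) :
    ∃ c, a < c ∧ c < b ∧ f.derivative.eval c = 0 := by
  obtain ⟨q1, hq1, hna⟩ := exists_eq_pow_rootMultiplicity_mul_and_not_dvd f hf a
  have hq1z : q1 ≠ 0 := by rintro rfl; simp at hna
  have hmpos : 0 < f.rootMultiplicity a := (rootMultiplicity_pos hf).2 ha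
  obtain ⟨q, hq, hnb⟩ := exists_eq_pow_rootMultiplicity_mul_and_not_dvd q1 hq1z b
  have hnpos : 0 < q1.rootMultiplicity b := by
    refine (rootMultiplicity_pos hq1z).2 ?_
    have h := hb
    rw [hq1, eval_mul, eval_pow, eval_sub, eval_X, eval_C] at h
    exact (mul_eq_zero.1 h).resolve_left (pow_ne_zero _ (sub_ne_zero.2 hab.ne'))
  rw [dvd_iff_isRoot] at hna hnb
  obtain ⟨m, hm⟩ := Nat.exists_eq_succ_of_ne_zero hmpos.ne'
  obtain ⟨n, hn⟩ := Nat.exists_eq_succ_of_ne_zero hnpos.ne'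
  rw [hm] at hq1
  rw [hn] at hq
  have hqa : q.eval a ≠ 0 := fun h => hna (by rw [hq, IsRoot, eval_mul, h, mul_zero])
  have hfq : f = (X - C a) ^ (m + 1) * ((X - C b) ^ (n + 1) * q) := hq1.trans (by rw [hq])
  have hqpos : 0 < q.eval a * q.eval b := by
    refine mul_eval_pos_of_forall_ne hab.le fun c h1 h2 h3 => ?_
    rcases h1.eq_or_lt with rfl | h1
    · exact hqa h3
    rcases h2.eq_or_lt with rfl | h2
    · exact hnb h3
    · exact hno c h1 h2 (by rw [hfq, eval_mul, eval_mul, h3, mul_zero, mul_zero])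
  let g : K[X] := C ((m : K) + 1) * (X - C b) * q + C ((n : K) + 1) * (X - C a) * q
    + (X - C a) * (X - C b) * derivative q
  have hder : derivative f = (X - C a) ^ m * (X - C b) ^ n * g := by
    rw [hfq]
    simp only [derivative_mul, derivative_pow, derivative_sub, derivative_X, derivative_C, g,
      Nat.cast_add, Nat.cast_one, Nat.add_sub_cancel]
    simp only [map_add, map_one, map_natCast]
    ring
  have hg : g.eval a * g.eval b < 0 := by
    have h1 : g.eval a * g.eval b
        = -(((m : K) + 1) * ((n : K) + 1) * (b - a) ^ 2 * (q.eval a * q.eval b)) := by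
      simp only [g, eval_add, eval_mul, eval_C, eval_sub, eval_X, sub_self]
      ring
    have h2 : 0 < b - a := sub_pos.2 hab
    rw [h1, neg_lt_zero]
    positivity
  obtain ⟨c, h1, h2, h3⟩ := exists_root_of_mul_neg hab hg
  exact ⟨c, h1, h2, by rw [hder, eval_mul, h3, mul_zero]⟩

theorem exists_derivative_root_between {f : K[X]} {a b : K} (hab : a < b) (hf : f ≠ 0)
    (ha : f.eval a = 0) (hb : f.eval b = 0) :
    ∃ c, a < c ∧ c < b ∧ f.derivative.eval c = 0 := by
  classical
  -- The smallest root beyond a is consecutive to a.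
  let s := f.roots.toFinset.filter fun c => a < c ∧ c ≤ b
  have hs : ∀ c, c ∈ s ↔ f.eval c = 0 ∧ a < c ∧ c ≤ b := by
    intro c; simp [s, hf]
  have hne : s.Nonempty := ⟨b, (hs b).2 ⟨hb, hab, le_rfl⟩⟩
  obtain ⟨h1, h2, h3⟩ := (hs _).1 (s.min'_mem hne)
  obtain ⟨c, hc1, hc2, hc3⟩ := exists_derivative_root_of_consecutive h2 hf ha h1
    fun c hc1 hc2 hc3 => absurd (s.min'_le c ((hs c).2 ⟨hc3, hc1, hc2.le.trans h3⟩)) (not_le.2 hc2)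
  exact ⟨c, hc1, hc2.trans_le h3, hc3⟩

/-- If `f` has a root strictly between `a` and `b`, where its derivative does not vanish, then it
changes sign. -/
theorem mul_eval_neg_of_root {f : K[X]} {a b c : K} (hac : a < c) (hcb : c < b)
    (hc : f.eval c = 0) (hd : ∀ x, a < x → x < b → f.derivative.eval x ≠ 0) :
    f.eval a * f.eval b < 0 := by
  obtain ⟨q, rfl⟩ := dvd_iff_isRoot.2 hc
  have hq : q.eval c ≠ 0 := by
    have := hd c hac hcb
    simpa [derivative_mul] using this
  have hne : (X - C c) * q ≠ 0 := by
    refine mul_ne_zero (X_sub_C_ne_zero c) ?_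
    rintro rfl
    simp at hq
  have hpos : 0 < q.eval a * q.eval b := by
    -- The cofactor q has constant sign: another root of it would, by Rolle, give a critical point
    -- strictly inside, and q(c) is the derivative at c.
    refine mul_eval_pos_of_forall_ne (hac.trans hcb).le fun x h1 h2 h3 => ?_
    have hx : ((X - C c) * q).eval x = 0 := by rw [eval_mul, h3, mul_zero]
    rcases lt_trichotomy x c with h | rfl | h
    · obtain ⟨y, hy1, hy2, hy3⟩ := exists_derivative_root_between h hne hx hc
      exact hd y (h1.trans_lt hy1) (hy2.trans hcb) hy3
    · exact hq h3
    · obtain ⟨y, hy1, hy2, hy3⟩ := exists_derivative_root_between h hne hc hx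
      exact hd y (hac.trans hy1) (hy2.trans_le h2) hy3
  simp only [eval_mul, eval_sub, eval_X, eval_C]
  nlinarith [mul_pos (mul_pos (sub_pos.2 hac) (sub_pos.2 hcb)) hpos]

end RealClosedField

/-! ### Matched points and sign tables over two ordered fields. -/

section SignTable

open Polynomial

section Order

variable {K L : Type} [LinearOrder K] [LinearOrder L]

/-- The points `c` and `d` have the same position with respect to the matched points of `S`. -/
def Match (S : Finset (K × L)) (c : K) (d : L) : Prop :=
  ∀ s ∈ S, (c < s.1 ↔ d < s.2) ∧ (s.1 < c ↔ s.2 < d)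

theorem Match.mono {S T : Finset (K × L)} {c : K} {d : L} (h : Match S c d) (hT : T ⊆ S) :
    Match T c d := fun s hs => h s (hT hs)

theorem Match.eq_iff {S : Finset (K × L)} {c : K} {d : L} (h : Match S c d) {s : K × L}
    (hs : s ∈ S) : c = s.1 ↔ d = s.2 := by
  have h1 := h s hs
  constructor
  · rintro rfl
    exact le_antisymm (not_lt.1 fun h' => lt_irrefl _ (h1.2.2 h'))
      (not_lt.1 fun h' => lt_irrefl _ (h1.1.2 h'))
  · rintro rfl
    exact le_antisymm (not_lt.1 fun h' => lt_irrefl _ (h1.2.1 h'))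
      (not_lt.1 fun h' => lt_irrefl _ (h1.1.1 h'))

theorem Match.swap {S : Finset (K × L)} {c : K} {d : L} :
    Match (S.map (Equiv.prodComm K L).toEmbedding) d c ↔ Match S c d := by
  constructor
  · intro h s hs
    have := h s.swap (Finset.mem_map.2 ⟨s, hs, rfl⟩)
    exact ⟨this.1.symm, this.2.symm⟩
  · intro h s hs
    obtain ⟨t, ht, rfl⟩ := Finset.mem_map.1 hs
    exact ⟨(h t ht).1.symm, (h t ht).2.symm⟩

/-- Finitely many points cut out either a point or an open gap, and in a dense order without
endpoints the corresponding gap on the other side is nonempty. -/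
theorem exists_match [DenselyOrdered L] [NoMinOrder L] [NoMaxOrder L] [Nonempty L]
    {S : Finset (K × L)} (hS : ∀ s ∈ S, Match S s.1 s.2) (c : K) : ∃ d, Match S c d := by
  by_cases hc : ∃ s ∈ S, s.1 = c
  · obtain ⟨s, hs, rfl⟩ := hc
    exact ⟨s.2, hS s hs⟩
  push Not at hc
  obtain ⟨d, h1, h2⟩ := Order.exists_between_finsets ((S.filter fun s => s.1 < c).image Prod.snd)
    ((S.filter fun s => c < s.1).image Prod.snd) (by
      intro x hx y hy
      simp only [Finset.mem_image, Finset.mem_filter] at hx hy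
      obtain ⟨s, ⟨hs, hsc⟩, rfl⟩ := hx
      obtain ⟨t, ⟨ht, htc⟩, rfl⟩ := hy
      exact ((hS s hs t ht).1).1 (hsc.trans htc))
  have h1' : ∀ s ∈ S, s.1 < c → s.2 < d := fun s hs h =>
    h1 _ (Finset.mem_image_of_mem _ (Finset.mem_filter.2 ⟨hs, h⟩))
  have h2' : ∀ s ∈ S, c < s.1 → d < s.2 := fun s hs h =>
    h2 _ (Finset.mem_image_of_mem _ (Finset.mem_filter.2 ⟨hs, h⟩))
  refine ⟨d, fun s hs => ?_⟩
  rcases lt_or_gt_of_ne (hc s hs) with h | h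
  · have := h1' s hs h
    simp [h, this, h.not_gt, this.not_gt]
  · have := h2' s hs h
    simp [h, this, h.not_gt, this.not_gt]

/-- The nearest matched points on the two sides of c; every point of the gap between their partners
has the same position as c. -/
theorem exists_adjacent {S : Finset (K × L)} (hS : ∀ s ∈ S, Match S s.1 s.2) {c : K}
    (hc : ∀ s ∈ S, s.1 ≠ c) (hlo : ∃ s ∈ S, s.1 < c) (hhi : ∃ s ∈ S, c < s.1) :
    ∃ s ∈ S, ∃ t ∈ S, s.1 < c ∧ c < t.1 ∧ (∀ u ∈ S, s.1 < u.1 → u.1 < t.1 → False) ∧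
      ∀ d, s.2 < d → d < t.2 → Match S c d := by
  obtain ⟨s, hs, hsm⟩ := (S.filter fun s => s.1 < c).exists_max_image Prod.fst
    (by obtain ⟨s, hs, h⟩ := hlo; exact ⟨s, Finset.mem_filter.2 ⟨hs, h⟩⟩)
  obtain ⟨t, ht, htm⟩ := (S.filter fun s => c < s.1).exists_min_image Prod.fst
    (by obtain ⟨s, hs, h⟩ := hhi; exact ⟨s, Finset.mem_filter.2 ⟨hs, h⟩⟩)
  simp only [Finset.mem_filter] at hs ht hsm htm
  refine ⟨s, hs.1, t, ht.1, hs.2, ht.2, fun u hu h1 h2 => ?_, fun d h1 h2 u hu => ?_⟩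
  · rcases lt_or_gt_of_ne (hc u hu) with h | h
    · exact not_lt.2 (hsm u ⟨hu, h⟩) h1
    · exact not_lt.2 (htm u ⟨hu, h⟩) h2
  · rcases lt_or_gt_of_ne (hc u hu) with h | h
    · have h3 : u.2 ≤ s.2 := not_lt.1 fun h' =>
        not_lt.2 (hsm u ⟨hu, h⟩) ((hS s hs.1 u hu).1.2 h')
      have h4 := h3.trans_lt h1
      simp [h, h4, h.not_gt, h4.not_gt]
    · have h3 : t.2 ≤ u.2 := not_lt.1 fun h' =>
        not_lt.2 (htm u ⟨hu, h⟩) ((hS t ht.1 u hu).2.2 h')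
      have h4 := h2.trans_le h3
      simp [h, h4, h.not_gt, h4.not_gt]

theorem match_union {S T : Finset (K × L)} [DecidableEq (K × L)]
    (hS : ∀ s ∈ S, Match S s.1 s.2) (hT : ∀ t ∈ T, Match S t.1 t.2)
    (hTT : ∀ t ∈ T, Match T t.1 t.2) : ∀ s ∈ S ∪ T, Match (S ∪ T) s.1 s.2 := by
  intro s hs u hu
  rcases Finset.mem_union.1 hs with hs | hs <;> rcases Finset.mem_union.1 hu with hu | hu
  · exact hS s hs u hu
  · have := hT u hu s hs
    exact ⟨this.2, this.1⟩
  · exact hT s hs u hu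
  · exact hTT s hs u hu

end Order

section Field

variable {K L : Type} [Field K] [LinearOrder K] [IsStrictOrderedRing K]
  [Field L] [LinearOrder L] [IsStrictOrderedRing L]

/-- Horner's scheme: P = X · `P.divX` + P(0). The uniform bound δ, rather than mere positivity, lets
the product with x outgrow the constant term in a field that may be non-Archimedean. -/
theorem exists_forall_ge_le_eval {P : K[X]} (h : 0 < P.leadingCoeff) :
    ∃ δ > 0, ∃ M, ∀ x ≥ M, δ ≤ P.eval x := by
  induction hn : P.natDegree generalizing P with
  | zero =>
    rw [eq_C_of_natDegree_eq_zero hn] at h ⊢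
    rw [leadingCoeff_C] at h
    exact ⟨_, h, 0, fun x _ => by rw [eval_C]⟩
  | succ n ih =>
    have h1 : P.divX.natDegree = n := by rw [natDegree_divX_eq_natDegree_tsub_one, hn]; rfl
    have h2 : P.divX.leadingCoeff = P.leadingCoeff := by
      rw [leadingCoeff, leadingCoeff, h1, hn, coeff_divX]
    obtain ⟨δ, hδ, M, hM⟩ := ih (h2 ▸ h) h1
    refine ⟨δ, hδ, max M (max 0 ((δ - P.coeff 0) / δ)), fun x hx => ?_⟩
    simp only [ge_iff_le, max_le_iff] at hx
    have h3 := mul_le_mul_of_nonneg_left (hM x hx.1) hx.2.1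
    have h4 := (div_le_iff₀ hδ).1 hx.2.2
    have h5 : P.eval x = x * P.divX.eval x + P.coeff 0 := by
      conv_lhs => rw [← P.divX_mul_X_add]
      rw [eval_add, eval_mul, eval_X, eval_C, mul_comm]
    rw [h5]
    linarith

theorem exists_forall_ge_sign_eval {P : K[X]} (h : P ≠ 0) :
    ∃ M, ∀ x ≥ M, SignType.sign (P.eval x) = SignType.sign P.leadingCoeff := by
  rcases (leadingCoeff_ne_zero.2 h).lt_or_gt with h1 | h1
  · obtain ⟨δ, hδ, M, hM⟩ := exists_forall_ge_le_eval (P := -P) (by simpa using h1)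
    refine ⟨M, fun x hx => ?_⟩
    have := hM x hx
    rw [eval_neg] at this
    rw [sign_neg h1, sign_neg (by linarith)]
  · obtain ⟨δ, hδ, M, hM⟩ := exists_forall_ge_le_eval h1
    refine ⟨M, fun x hx => ?_⟩
    rw [sign_pos h1, sign_pos (hδ.trans_le (hM x hx))]

theorem exists_forall_le_sign_eval {P : K[X]} (h : P ≠ 0) :
    ∃ M, ∀ x ≤ M, SignType.sign (P.eval x)
      = SignType.sign P.leadingCoeff * (-1) ^ P.natDegree := by
  have h1 : P.comp (-X) ≠ 0 := by
    rw [Ne, comp_eq_zero_iff]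
    rintro (h1 | ⟨-, h1⟩)
    · exact h h1
    · have := congrArg (coeff · 1) h1
      simp at this
  obtain ⟨M, hM⟩ := exists_forall_ge_sign_eval h1
  refine ⟨-M, fun x hx => ?_⟩
  have h2 := hM (-x) (by linarith)
  rw [eval_comp, eval_neg, eval_X, neg_neg, leadingCoeff_comp (by simp)] at h2
  rw [h2, sign_mul, leadingCoeff_neg, leadingCoeff_X, sign_pow, Left.sign_neg, sign_one]

theorem degree_eq_of_coeff_eq_zero_iff {P : K[X]} {Q : L[X]}
    (h : ∀ n, P.coeff n = 0 ↔ Q.coeff n = 0) : P.degree = Q.degree := by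
  have : P.support = Q.support := by
    ext n; rw [mem_support_iff, mem_support_iff, Ne, h]
  rw [degree, degree, this]

/-- The finite set `S` of matched points witnesses that the pairs of polynomials in `Q` have the
same sign tables over the two fields. -/
structure IsTable (Q : Set (K[X] × L[X])) (S : Finset (K × L)) : Prop where
  mono : ∀ s ∈ S, Match S s.1 s.2
  sign : ∀ c d, Match S c d → ∀ g ∈ Q,
    SignType.sign (g.1.eval c) = SignType.sign (g.2.eval d)
  left : ∀ g ∈ Q, g.1 ≠ 0 → ∀ c, g.1.eval c = 0 → ∃ s ∈ S, s.1 = c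
  right : ∀ g ∈ Q, g.2 ≠ 0 → ∀ d, g.2.eval d = 0 → ∃ s ∈ S, s.2 = d

theorem IsTable.subset {Q Q' : Set (K[X] × L[X])} {S : Finset (K × L)} (h : IsTable Q S)
    (hQ : Q' ⊆ Q) : IsTable Q' S :=
  ⟨h.mono, fun c d hcd g hg => h.sign c d hcd g (hQ hg), fun g hg => h.left g (hQ hg),
    fun g hg => h.right g (hQ hg)⟩

theorem IsTable.union {Q : Set (K[X] × L[X])} {S T : Finset (K × L)} [DecidableEq (K × L)]
    (h : IsTable Q S) (hT : ∀ t ∈ T, Match S t.1 t.2) (hTT : ∀ t ∈ T, Match T t.1 t.2) :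
    IsTable Q (S ∪ T) where
  mono := match_union h.mono hT hTT
  sign c d hcd := h.sign c d (hcd.mono Finset.subset_union_left)
  left g hg h0 c hc := by
    obtain ⟨s, hs, h1⟩ := h.left g hg h0 c hc
    exact ⟨s, Finset.mem_union_left _ hs, h1⟩
  right g hg h0 c hc := by
    obtain ⟨s, hs, h1⟩ := h.right g hg h0 c hc
    exact ⟨s, Finset.mem_union_left _ hs, h1⟩

theorem sign_eq_of_mul_pos {a b : K} (h : 0 < a * b) : SignType.sign a = SignType.sign b := by
  rcases pos_and_pos_or_neg_and_neg_of_mul_pos h with h | h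
  · rw [sign_pos h.1, sign_pos h.2]
  · rw [sign_neg h.1, sign_neg h.2]

theorem eq_zero_iff_of_sign_eq {a : K} {b : L} (h : SignType.sign a = SignType.sign b) :
    a = 0 ↔ b = 0 := by rw [← sign_eq_zero_iff, h, sign_eq_zero_iff]

theorem mul_neg_of_sign_eq {a a' : K} {b b' : L} (h : SignType.sign a = SignType.sign b)
    (h' : SignType.sign a' = SignType.sign b') (hn : a * a' < 0) : b * b' < 0 := by
  rw [← sign_eq_neg_one_iff] at hn ⊢
  rw [sign_mul, ← h, ← h', ← sign_mul, hn]

end Field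

section Refine

variable {K L : Type} [Field K] [LinearOrder K] [IsStrictOrderedRing K] [IsRealClosed K]
  [Field L] [LinearOrder L] [IsStrictOrderedRing L] [IsRealClosed L]

theorem sign_eval_eq_of_forall_ne {P : K[X]} {a b : K}
    (h : ∀ c, min a b ≤ c → c ≤ max a b → P.eval c ≠ 0) :
    SignType.sign (P.eval a) = SignType.sign (P.eval b) := by
  rcases le_total a b with hab | hab
  · rw [min_eq_left hab, max_eq_right hab] at h
    exact sign_eq_of_mul_pos (mul_eval_pos_of_forall_ne hab h)
  · rw [min_eq_right hab, max_eq_left hab] at h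
    exact (sign_eq_of_mul_pos (mul_eval_pos_of_forall_ne hab h)).symm

/-- Points that are not needed as roots can be dropped. If c and d match for the smaller set and c
and d' for the larger one, then no root of g.2 separates or meets d and d' unless they coincide,
because the remaining points contain all roots and both lie on the same side of each. -/
theorem IsTable.restrict {Q : Set (K[X] × L[X])} {S S' : Finset (K × L)} (h : IsTable Q S)
    (hS : S' ⊆ S) (left : ∀ g ∈ Q, g.1 ≠ 0 → ∀ c, g.1.eval c = 0 → ∃ s ∈ S', s.1 = c)
    (right : ∀ g ∈ Q, g.2 ≠ 0 → ∀ d, g.2.eval d = 0 → ∃ s ∈ S', s.2 = d) :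
    IsTable Q S' where
  mono s hs := (h.mono s (hS hs)).mono hS
  left := left
  right := right
  sign c d hcd g hg := by
    obtain ⟨d', hd'⟩ := exists_match h.mono c
    rw [h.sign c d' hd' g hg]
    have hd := hd'.mono hS
    by_cases h0 : g.2 = 0
    · simp [h0]
    rcases eq_or_ne d' d with rfl | hne
    · rfl
    refine sign_eval_eq_of_forall_ne fun z h1 h2 h3 => ?_
    obtain ⟨s, hs, rfl⟩ := right g hg h0 z h3
    have e1 : d < s.2 ↔ d' < s.2 := (hcd s hs).1.symm.trans (hd s hs).1
    have e2 : s.2 < d ↔ s.2 < d' := (hcd s hs).2.symm.trans (hd s hs).2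
    have e3 : d = s.2 ↔ d' = s.2 := (hcd.eq_iff hs).symm.trans (hd.eq_iff hs)
    rcases lt_trichotomy d s.2 with h4 | h4 | h4
    · exact not_lt.2 h2 (max_lt (e1.1 h4) h4)
    · exact hne ((e3.1 h4).trans h4.symm)
    · exact not_lt.2 h1 (lt_min (e2.1 h4) h4)

end Refine

end SignTable

/-! ### Adding one polynomial to a sign table. -/

section SignTableStep

open Polynomial

variable {K L : Type} [Field K] [LinearOrder K] [IsStrictOrderedRing K] [IsRealClosed K]
  [Field L] [LinearOrder L] [IsStrictOrderedRing L] [IsRealClosed L]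

/-- The matched points determine the signs of a pair of polynomials: they contain matched points
beyond which the signs are constant, their signs agree at the matched points, and all roots of the
derivative are matched. -/
structure IsFrame (P : K[X]) (P' : L[X]) (S : Finset (K × L)) : Prop where
  mono : ∀ s ∈ S, Match S s.1 s.2
  sign : ∀ s ∈ S, SignType.sign (P.eval s.1) = SignType.sign (P'.eval s.2)
  left : ∀ c, (derivative P).eval c = 0 → ∃ s ∈ S, s.1 = c
  right : ∀ d, (derivative P').eval d = 0 → ∃ s ∈ S, s.2 = d
  top : ∃ s ∈ S, ∀ c d, s.1 ≤ c → s.2 ≤ d →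
    SignType.sign (P.eval c) = SignType.sign (P'.eval d) ∧ P.eval c ≠ 0
  bot : ∃ s ∈ S, ∀ c d, c ≤ s.1 → d ≤ s.2 →
    SignType.sign (P.eval c) = SignType.sign (P'.eval d) ∧ P.eval c ≠ 0

theorem IsFrame.swap {P : K[X]} {P' : L[X]} {S : Finset (K × L)} (h : IsFrame P P' S) :
    IsFrame P' P (S.map (Equiv.prodComm K L).toEmbedding) where
  mono s hs := by
    obtain ⟨t, ht, rfl⟩ := Finset.mem_map.1 hs
    exact Match.swap.2 (h.mono t ht)
  sign s hs := by
    obtain ⟨t, ht, rfl⟩ := Finset.mem_map.1 hs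
    exact (h.sign t ht).symm
  left c hc := by
    obtain ⟨s, hs, h1⟩ := h.right c hc
    exact ⟨s.swap, Finset.mem_map.2 ⟨s, hs, rfl⟩, h1⟩
  right c hc := by
    obtain ⟨s, hs, h1⟩ := h.left c hc
    exact ⟨s.swap, Finset.mem_map.2 ⟨s, hs, rfl⟩, h1⟩
  top := by
    obtain ⟨s, hs, h1⟩ := h.top
    refine ⟨s.swap, Finset.mem_map.2 ⟨s, hs, rfl⟩, fun c d hc hd => ?_⟩
    have h2 := h1 d c hd hc
    exact ⟨h2.1.symm, fun h3 => h2.2 ((eq_zero_iff_of_sign_eq h2.1).2 h3)⟩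
  bot := by
    obtain ⟨s, hs, h1⟩ := h.bot
    refine ⟨s.swap, Finset.mem_map.2 ⟨s, hs, rfl⟩, fun c d hc hd => ?_⟩
    have h2 := h1 d c hd hc
    exact ⟨h2.1.symm, fun h3 => h2.2 ((eq_zero_iff_of_sign_eq h2.1).2 h3)⟩

/-- Inside a gap the derivative has no root, so a root of P there forces opposite signs at the two
ends. The partners of the ends carry the same signs, and the intermediate value property gives a
root of P' between them. -/
theorem IsFrame.exists_root {P : K[X]} {P' : L[X]} {S : Finset (K × L)} (h : IsFrame P P' S)
    {c : K} (hc : P.eval c = 0) : ∃ d, P'.eval d = 0 ∧ Match S c d := by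
  by_cases hcS : ∃ s ∈ S, s.1 = c
  · obtain ⟨s, hs, rfl⟩ := hcS
    exact ⟨s.2, (eq_zero_iff_of_sign_eq (h.sign s hs)).1 hc, h.mono s hs⟩
  push Not at hcS
  obtain ⟨a, ha, ha'⟩ := h.top
  obtain ⟨b, hb, hb'⟩ := h.bot
  obtain ⟨s, hs, t, ht, hsc, hct, hno, hm⟩ := exists_adjacent h.mono hcS
    ⟨b, hb, not_le.1 fun h' => (hb' c b.2 h' le_rfl).2 hc⟩
    ⟨a, ha, not_le.1 fun h' => (ha' c a.2 h' le_rfl).2 hc⟩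
  have h1 := mul_eval_neg_of_root hsc hct hc fun x hx1 hx2 hx3 => by
    obtain ⟨u, hu, rfl⟩ := h.left x hx3
    exact hno u hu hx1 hx2
  have h2 := mul_neg_of_sign_eq (h.sign s hs) (h.sign t ht) h1
  obtain ⟨d, h3, h4, h5⟩ := exists_root_of_mul_neg
    ((h.mono s hs t ht).1.1 (hsc.trans hct)) h2
  exact ⟨d, h5, hm d h3 h4⟩

/-- A frame that contains all the roots determines the signs everywhere. -/
theorem IsFrame.sign_eq {P : K[X]} {P' : L[X]} {S : Finset (K × L)} (h : IsFrame P P' S)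
    (hP : P ≠ 0) (hleft : ∀ c, P.eval c = 0 → ∃ s ∈ S, s.1 = c)
    (hright : ∀ d, P'.eval d = 0 → ∃ s ∈ S, s.2 = d) {c : K} {d : L} (hcd : Match S c d) :
    SignType.sign (P.eval c) = SignType.sign (P'.eval d) := by
  by_cases hcS : ∃ s ∈ S, s.1 = c
  · obtain ⟨s, hs, rfl⟩ := hcS
    rw [h.sign s hs, (hcd.eq_iff hs).1 rfl]
  push Not at hcS
  obtain ⟨a, ha, ha'⟩ := h.top
  obtain ⟨b, hb, hb'⟩ := h.bot
  by_cases hac : a.1 ≤ c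
  · refine (ha' c d hac (not_lt.1 fun h' => ?_)).1
    exact not_lt.2 hac ((hcd a ha).1.2 h')
  by_cases hbc : c ≤ b.1
  · refine (hb' c d hbc (not_lt.1 fun h' => ?_)).1
    exact not_lt.2 hbc ((hcd b hb).2.2 h')
  obtain ⟨s, hs, t, ht, hsc, hct, hno, hm⟩ := exists_adjacent h.mono hcS
    ⟨b, hb, not_le.1 hbc⟩ ⟨a, ha, not_le.1 hac⟩
  have hsd := (hcd s hs).2.1 hsc
  have hdt := (hcd t ht).1.1 hct
  have hno' : ∀ u ∈ S, s.2 < u.2 → u.2 < t.2 → False := fun u hu h1 h2 =>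
    hno u hu ((h.mono s hs u hu).1.2 h1) ((h.mono t ht u hu).2.2 h2)
  -- An end of the gap where P does not vanish transmits its sign to c, and its partner to d,
  -- because no root lies on the way. By Rolle, P cannot vanish at both ends.
  have key : ∀ u ∈ S, (u = s ∨ u = t) → P.eval u.1 ≠ 0 →
      SignType.sign (P.eval c) = SignType.sign (P'.eval d) := by
    intro u hu hust h0
    have h0' : P'.eval u.2 ≠ 0 := fun h' => h0 ((eq_zero_iff_of_sign_eq (h.sign u hu)).2 h')
    have e1 : SignType.sign (P.eval c) = SignType.sign (P.eval u.1) := by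
      refine sign_eval_eq_of_forall_ne fun z h1 h2 h3 => ?_
      obtain ⟨v, hv, rfl⟩ := hleft z h3
      have hvu : v.1 ≠ u.1 := fun h' => h0 (h' ▸ h3)
      have hvc := hcS v hv
      rcases hust with rfl | rfl
      · rw [min_eq_right hsc.le] at h1
        rw [max_eq_left hsc.le] at h2
        exact hno v hv (lt_of_le_of_ne h1 hvu.symm) (h2.trans_lt hct)
      · rw [min_eq_left hct.le] at h1
        rw [max_eq_right hct.le] at h2
        exact hno v hv (hsc.trans_le h1) (lt_of_le_of_ne h2 hvu)
    have e2 : SignType.sign (P'.eval d) = SignType.sign (P'.eval u.2) := by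
      refine sign_eval_eq_of_forall_ne fun z h1 h2 h3 => ?_
      obtain ⟨v, hv, rfl⟩ := hright z h3
      have hvu : v.2 ≠ u.2 := fun h' => h0' (h' ▸ h3)
      rcases hust with rfl | rfl
      · rw [min_eq_right hsd.le] at h1
        rw [max_eq_left hsd.le] at h2
        exact hno' v hv (lt_of_le_of_ne h1 hvu.symm) (h2.trans_lt hdt)
      · rw [min_eq_left hdt.le] at h1
        rw [max_eq_right hdt.le] at h2
        exact hno' v hv (hsd.trans_le h1) (lt_of_le_of_ne h2 hvu)
    rw [e1, h.sign u hu, e2]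
  by_cases h1 : P.eval s.1 = 0
  · by_cases h2 : P.eval t.1 = 0
    · obtain ⟨x, hx1, hx2, hx3⟩ := exists_derivative_root_between (hsc.trans hct) hP h1 h2
      obtain ⟨u, hu, rfl⟩ := h.left x hx3
      exact (hno u hu hx1 hx2).elim
    · exact key t ht (Or.inr rfl) h2
  · exact key s hs (Or.inl rfl) h1

/-- Two roots are separated by a root of the derivative, which is a matched point. So matching roots
come in the same order on both sides. -/
theorem IsFrame.match_roots {P : K[X]} {P' : L[X]} {S : Finset (K × L)} (h : IsFrame P P' S)
    (hP : P ≠ 0) (hP' : P' ≠ 0) {c c' : K} {d d' : L} (hc : P.eval c = 0) (hc' : P.eval c' = 0)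
    (hd : P'.eval d = 0) (hd' : P'.eval d' = 0) (hcd : Match S c d) (hcd' : Match S c' d') :
    c < c' ↔ d < d' := by
  constructor
  · intro hlt
    obtain ⟨x, h1, h2, h3⟩ := exists_derivative_root_between hlt hP hc hc'
    obtain ⟨s, hs, rfl⟩ := h.left x h3
    exact ((hcd s hs).1.1 h1).trans ((hcd' s hs).2.1 h2)
  · intro hlt
    obtain ⟨x, h1, h2, h3⟩ := exists_derivative_root_between hlt hP' hd hd'
    obtain ⟨s, hs, rfl⟩ := h.right x h3
    exact ((hcd s hs).1.2 h1).trans ((hcd' s hs).2.2 h2)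

theorem IsFrame.exists_table {Q : Set (K[X] × L[X])} {P : K[X] × L[X]} {S : Finset (K × L)}
    (h : IsFrame P.1 P.2 S) (hP : P.1 ≠ 0) (hP' : P.2 ≠ 0) (hQ : IsTable Q S) :
    ∃ S', IsTable (insert P Q) S' := by
  classical
  -- The new points are the pairs of roots with the same position relative to S. They are
  -- consistently ordered, and adding them captures all roots of both polynomials.
  let T := (P.1.roots.toFinset ×ˢ P.2.roots.toFinset).filter fun t => Match S t.1 t.2
  have hT : ∀ t, t ∈ T ↔ P.1.eval t.1 = 0 ∧ P.2.eval t.2 = 0 ∧ Match S t.1 t.2 := by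
    intro t; simp [T, hP, hP', and_assoc]
  have hTS : ∀ t ∈ T, Match S t.1 t.2 := fun t ht => ((hT t).1 ht).2.2
  have hTT : ∀ t ∈ T, Match T t.1 t.2 := fun t ht u hu => by
    obtain ⟨a1, a2, a3⟩ := (hT t).1 ht
    obtain ⟨b1, b2, b3⟩ := (hT u).1 hu
    exact ⟨h.match_roots hP hP' a1 b1 a2 b2 a3 b3, h.match_roots hP hP' b1 a1 b2 a2 b3 a3⟩
  have hU := hQ.union hTS hTT
  have hF : IsFrame P.1 P.2 (S ∪ T) := by
    refine ⟨hU.mono, fun s hs => ?_, fun c hc => ?_, fun c hc => ?_, ?_, ?_⟩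
    · rcases Finset.mem_union.1 hs with hs | hs
      · exact h.sign s hs
      · obtain ⟨a1, a2, -⟩ := (hT s).1 hs
        rw [a1, a2, sign_zero, sign_zero]
    · obtain ⟨s, hs, h1⟩ := h.left c hc
      exact ⟨s, Finset.mem_union_left _ hs, h1⟩
    · obtain ⟨s, hs, h1⟩ := h.right c hc
      exact ⟨s, Finset.mem_union_left _ hs, h1⟩
    · obtain ⟨s, hs, h1⟩ := h.top
      exact ⟨s, Finset.mem_union_left _ hs, h1⟩
    · obtain ⟨s, hs, h1⟩ := h.bot
      exact ⟨s, Finset.mem_union_left _ hs, h1⟩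
  have hl : ∀ c, P.1.eval c = 0 → ∃ s ∈ S ∪ T, s.1 = c := by
    intro c hc
    obtain ⟨d, hd, hcd⟩ := h.exists_root hc
    exact ⟨(c, d), Finset.mem_union_right _ ((hT _).2 ⟨hc, hd, hcd⟩), rfl⟩
  have hr : ∀ d, P.2.eval d = 0 → ∃ s ∈ S ∪ T, s.2 = d := by
    intro d hd
    obtain ⟨c, hc, hcd⟩ := h.swap.exists_root hd
    exact ⟨(c, d), Finset.mem_union_right _ ((hT _).2 ⟨hc, hd, Match.swap.1 hcd⟩), rfl⟩
  refine ⟨S ∪ T, hU.mono, fun c d hcd g hg => ?_, fun g hg h0 c hc => ?_, fun g hg h0 d hd => ?_⟩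
  · rcases hg with rfl | hg
    · exact hF.sign_eq hP hl hr hcd
    · exact hU.sign c d hcd g hg
  · rcases hg with rfl | hg
    · exact hl c hc
    · exact hU.left g hg h0 c hc
  · rcases hg with rfl | hg
    · exact hr d hd
    · exact hU.right g hg h0 d hd

/-- Matched points beyond all given points, where two polynomials with the same coefficient signs
have constant signs. -/
theorem exists_top_match (S : Finset (K × L)) {P : K[X]} {P' : L[X]} (hP : P ≠ 0)
    (hco : ∀ n, SignType.sign (P.coeff n) = SignType.sign (P'.coeff n)) :
    ∃ a : K × L, (∀ s ∈ S, s.1 < a.1 ∧ s.2 < a.2) ∧ ∀ c d, a.1 ≤ c → a.2 ≤ d →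
      SignType.sign (P.eval c) = SignType.sign (P'.eval d) ∧ P.eval c ≠ 0 := by
  classical
  have hdeg := degree_eq_of_coeff_eq_zero_iff fun n => eq_zero_iff_of_sign_eq (hco n)
  have hnat := natDegree_eq_of_degree_eq hdeg
  have hP' : P' ≠ 0 := by rw [← degree_ne_bot, ← hdeg]; exact degree_ne_bot.2 hP
  have hlc : SignType.sign P.leadingCoeff = SignType.sign P'.leadingCoeff := by
    rw [leadingCoeff, leadingCoeff, ← hnat, hco]
  obtain ⟨M, hM⟩ := exists_forall_ge_sign_eval hP
  obtain ⟨M', hM'⟩ := exists_forall_ge_sign_eval hP'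
  obtain ⟨a, ha⟩ := (insert M (S.image Prod.fst)).exists_le
  obtain ⟨b, hb⟩ := (insert M' (S.image Prod.snd)).exists_le
  refine ⟨(a + 1, b + 1), fun s hs => ⟨?_, ?_⟩, fun c d hc hd => ?_⟩
  · exact (ha _ (Finset.mem_insert_of_mem (Finset.mem_image_of_mem _ hs))).trans_lt (lt_add_one a)
  · exact (hb _ (Finset.mem_insert_of_mem (Finset.mem_image_of_mem _ hs))).trans_lt (lt_add_one b)
  · have h1 := ha M (Finset.mem_insert_self _ _)
    have h2 := hb M' (Finset.mem_insert_self _ _)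
    rw [hM c ((h1.trans (lt_add_one a).le).trans hc),
      hM' d ((h2.trans (lt_add_one b).le).trans hd), ← sign_ne_zero (α := K),
      hM c ((h1.trans (lt_add_one a).le).trans hc), sign_ne_zero]
    exact ⟨hlc, leadingCoeff_ne_zero.2 hP⟩

theorem exists_bot_match (S : Finset (K × L)) {P : K[X]} {P' : L[X]} (hP : P ≠ 0)
    (hco : ∀ n, SignType.sign (P.coeff n) = SignType.sign (P'.coeff n)) :
    ∃ a : K × L, (∀ s ∈ S, a.1 < s.1 ∧ a.2 < s.2) ∧ ∀ c d, c ≤ a.1 → d ≤ a.2 →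
      SignType.sign (P.eval c) = SignType.sign (P'.eval d) ∧ P.eval c ≠ 0 := by
  classical
  have hdeg := degree_eq_of_coeff_eq_zero_iff fun n => eq_zero_iff_of_sign_eq (hco n)
  have hnat := natDegree_eq_of_degree_eq hdeg
  have hP' : P' ≠ 0 := by rw [← degree_ne_bot, ← hdeg]; exact degree_ne_bot.2 hP
  have hlc : SignType.sign P.leadingCoeff = SignType.sign P'.leadingCoeff := by
    rw [leadingCoeff, leadingCoeff, ← hnat, hco]
  obtain ⟨M, hM⟩ := exists_forall_le_sign_eval hP
  obtain ⟨M', hM'⟩ := exists_forall_le_sign_eval hP'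
  obtain ⟨a, ha⟩ := (insert M (S.image Prod.fst)).bddBelow
  obtain ⟨b, hb⟩ := (insert M' (S.image Prod.snd)).bddBelow
  refine ⟨(a - 1, b - 1), fun s hs => ⟨?_, ?_⟩, fun c d hc hd => ?_⟩
  · exact (sub_one_lt a).trans_le (ha (Finset.mem_insert_of_mem (Finset.mem_image_of_mem _ hs)))
  · exact (sub_one_lt b).trans_le (hb (Finset.mem_insert_of_mem (Finset.mem_image_of_mem _ hs)))
  · have h1 := ha (Finset.mem_insert_self _ _)
    have h2 := hb (Finset.mem_insert_self _ _)
    have h3 := hM c (hc.trans ((sub_one_lt a).le.trans h1))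
    have h4 := hM' d (hd.trans ((sub_one_lt b).le.trans h2))
    refine ⟨by rw [h3, h4, hlc, hnat], ?_⟩
    rw [← sign_ne_zero, h3]
    refine mul_ne_zero ?_ (pow_ne_zero _ (by decide))
    rw [sign_ne_zero]
    exact leadingCoeff_ne_zero.2 hP

/-- The inductive step of the sign table method: the derivative controls P between matched points,
the coefficients control it near infinity, and `hs` controls it at the roots of the old polynomials.
Together these make a frame. -/
theorem IsTable.exists_insert {Q : Set (K[X] × L[X])} {P : K[X] × L[X]} {S : Finset (K × L)}
    (h : IsTable Q S) (hD : (derivative P.1, derivative P.2) ∈ Q)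
    (hco : ∀ n, SignType.sign (P.1.coeff n) = SignType.sign (P.2.coeff n))
    (hz : ∀ g ∈ Q, g.1 = 0 ↔ g.2 = 0)
    (hs : ∀ s ∈ S, ∀ g ∈ Q, g.1 ≠ 0 → g.1.eval s.1 = 0 →
      SignType.sign (P.1.eval s.1) = SignType.sign (P.2.eval s.2)) :
    ∃ S', IsTable (insert P Q) S' := by
  classical
  have hdeg := degree_eq_of_coeff_eq_zero_iff fun n => eq_zero_iff_of_sign_eq (hco n)
  by_cases hd : derivative P.1 = 0
  · have h1 := eq_C_of_derivative_eq_zero hd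
    have h2 := eq_C_of_derivative_eq_zero ((hz _ hD).1 hd)
    refine ⟨S, h.mono, fun c d hcd g hg => ?_, fun g hg h0 c hc => ?_, fun g hg h0 d hd0 => ?_⟩
    · rcases hg with rfl | hg
      · rw [h1, h2, eval_C, eval_C, hco]
      · exact h.sign c d hcd g hg
    · rcases hg with rfl | hg
      · rw [h1, eval_C] at hc
        rw [hc, C_0] at h1
        exact absurd h1 h0
      · exact h.left g hg h0 c hc
    · rcases hg with rfl | hg
      · rw [h2, eval_C] at hd0
        rw [hd0, C_0] at h2
        exact absurd h2 h0
      · exact h.right g hg h0 d hd0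
  have hd' : derivative P.2 ≠ 0 := fun h' => hd ((hz _ hD).2 h')
  have hP : P.1 ≠ 0 := fun h' => hd (by rw [h', derivative_zero])
  have hP' : P.2 ≠ 0 := fun h' => hd' (by rw [h', derivative_zero])
  -- Only at roots of nonzero members of Q is the sign of P known to agree, so all other points are
  -- discarded.
  let S0 := S.filter fun s => ∃ g ∈ Q, g.1 ≠ 0 ∧ g.1.eval s.1 = 0
  have h0 : IsTable Q S0 := by
    refine h.restrict (Finset.filter_subset _ _) (fun g hg hg0 c hc => ?_)
      (fun g hg hg0 d hd => ?_)
    · obtain ⟨s, hsS, rfl⟩ := h.left g hg hg0 c hc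
      exact ⟨s, Finset.mem_filter.2 ⟨hsS, g, hg, hg0, hc⟩, rfl⟩
    · obtain ⟨s, hsS, rfl⟩ := h.right g hg hg0 d hd
      refine ⟨s, Finset.mem_filter.2 ⟨hsS, g, hg, fun h' => hg0 ((hz g hg).1 h'), ?_⟩, rfl⟩
      exact (eq_zero_iff_of_sign_eq (h.sign _ _ (h.mono s hsS) g hg)).2 hd
  obtain ⟨a, ha, ha'⟩ := exists_top_match S0 hP hco
  have hma : Match S0 a.1 a.2 := fun s hs => by
    have := ha s hs
    simp [this.1, this.2, this.1.not_gt, this.2.not_gt]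
  have h1 := h0.union (T := {a}) (fun t ht => by rwa [Finset.mem_singleton.1 ht])
    (fun t ht u hu => by simp [Finset.mem_singleton.1 ht, Finset.mem_singleton.1 hu])
  obtain ⟨b, hb, hb'⟩ := exists_bot_match (S0 ∪ {a}) hP hco
  have hmb : Match (S0 ∪ {a}) b.1 b.2 := fun s hs => by
    have := hb s hs
    simp [this.1, this.2, this.1.not_gt, this.2.not_gt]
  have h2 := h1.union (T := {b}) (fun t ht => by rwa [Finset.mem_singleton.1 ht])
    (fun t ht u hu => by simp [Finset.mem_singleton.1 ht, Finset.mem_singleton.1 hu])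
  have hF : IsFrame P.1 P.2 (S0 ∪ {a} ∪ {b}) := by
    refine ⟨h2.mono, fun s hsS => ?_, h2.left _ hD hd, h2.right _ hD hd',
      ⟨a, by simp, ha'⟩, ⟨b, by simp, hb'⟩⟩
    rcases Finset.mem_union.1 hsS with hsS | hsS
    · rcases Finset.mem_union.1 hsS with hsS | hsS
      · obtain ⟨hsS, g, hg, hg0, hgs⟩ := Finset.mem_filter.1 hsS
        exact hs s hsS g hg hg0 hgs
      · rw [Finset.mem_singleton.1 hsS]
        exact (ha' _ _ le_rfl le_rfl).1
    · rw [Finset.mem_singleton.1 hsS]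
      exact (hb' _ _ le_rfl le_rfl).1
  exact hF.exists_table hP hP' h2

end SignTableStep

/-! ### Transfer of sign conditions between real closed fields. -/

section Transfer

open Polynomial

section PseudoDivision

variable {R : Type} [CommRing R]

/-- The coefficient at k is only a formal leading coefficient and may be zero. Multiplying by it
replaces division, so the identity holds over any commutative ring and survives homomorphisms. -/
theorem exists_pseudo_division (p q : R[X]) {k : ℕ} (hq : q.natDegree ≤ k) :
    ∃ (m : ℕ) (s r : R[X]), C (q.coeff k) ^ m * p = q * s + r ∧ r.degree < k := by
  induction hn : p.natDegree using Nat.strong_induction_on generalizing p with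
  | _ n ih =>
    by_cases hp : p.degree < k
    · exact ⟨0, 0, p, by simp, hp⟩
    have hp0 : p ≠ 0 := by rintro rfl; simp at hp
    have hkn : k ≤ n := by
      rw [degree_eq_natDegree hp0, hn, not_lt] at hp
      exact_mod_cast hp
    let p1 := C (q.coeff k) * p - C (p.coeff n) * X ^ (n - k) * q
    have hdeg : p1.degree < n := by
      rw [degree_lt_iff_coeff_zero]
      intro i hi
      have h1 : (C (p.coeff n) * X ^ (n - k) * q).coeff i
          = p.coeff n * q.coeff (i - (n - k)) := by
        rw [mul_assoc, coeff_C_mul, coeff_X_pow_mul', if_pos (by omega)]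
      rw [coeff_sub, coeff_C_mul, h1]
      rcases hi.eq_or_lt with rfl | hi
      · rw [Nat.sub_sub_self hkn]; ring
      · have e1 : p.coeff i = 0 := coeff_eq_zero_of_natDegree_lt (by omega)
        have e2 : q.coeff (i - (n - k)) = 0 := coeff_eq_zero_of_natDegree_lt (by omega)
        rw [e1, e2, mul_zero, mul_zero, sub_zero]
    by_cases hp1 : p1 = 0
    · refine ⟨1, C (p.coeff n) * X ^ (n - k), 0, ?_, by simp⟩
      rw [pow_one, add_zero]
      linear_combination hp1
    obtain ⟨m, s, r, h1, h2⟩ := ih p1.natDegree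
      ((natDegree_lt_iff_degree_lt hp1).2 hdeg) p1 rfl
    refine ⟨m + 1, C (q.coeff k) ^ m * (C (p.coeff n) * X ^ (n - k)) + s, r, ?_, h2⟩
    simp only [p1] at h1
    linear_combination h1

/-- At a root of q, the polynomial p is, up to a nonzero factor, its pseudo-remainder. One remainder
serves all ordered fields and homomorphisms for which the image of q has degree k. -/
theorem exists_sign_remainder (p q : R[X]) (k : ℕ) : ∃ r : R[X], r.degree < k ∧
    ∀ {K : Type} [Field K] [LinearOrder K] [IsStrictOrderedRing K] (f : R →+* K) (z : K),
      (q.map f).degree = k → (q.map f).eval z = 0 →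
      SignType.sign ((p.map f).eval z) = SignType.sign ((r.map f).eval z) := by
  -- The coefficients of q above k are removed; they vanish under any homomorphism considered.
  let q' : R[X] := ∑ i ∈ Finset.range (k + 1), monomial i (q.coeff i)
  have hco : ∀ i, q'.coeff i = if i < k + 1 then q.coeff i else 0 := by
    intro i
    simp only [q', finsetSum_coeff, coeff_monomial, Finset.sum_ite_eq', Finset.mem_range]
  have hq' : q'.natDegree ≤ k := natDegree_le_iff_coeff_eq_zero.2 fun i hi => by
    rw [hco, if_neg (by omega)]
  obtain ⟨m, s, r, h1, h2⟩ := exists_pseudo_division p q' hq'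
  -- The additional power makes the factor in front of p a square, so the sign is preserved.
  refine ⟨C (q'.coeff k) ^ m * r, ?_, ?_⟩
  · rw [← C_pow, degree_lt_iff_coeff_zero]
    intro i hi
    rw [coeff_C_mul, (degree_lt_iff_coeff_zero _ _).1 h2 i hi, mul_zero]
  intro K _ _ _ f z hk hz
  have hmap : q'.map f = q.map f := by
    ext i
    rw [coeff_map, coeff_map, hco]
    split_ifs with hi
    · rfl
    · rw [map_zero, ← coeff_map, coeff_eq_zero_of_degree_lt]
      rw [hk]
      exact_mod_cast (show k < i by omega)
  have hc : f (q'.coeff k) ≠ 0 := by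
    rw [← coeff_map, hmap]
    exact coeff_ne_zero_of_eq_degree hk
  have h3 := congrArg (fun g => (g.map f).eval z) h1
  simp only [Polynomial.map_mul, Polynomial.map_add, Polynomial.map_pow, map_C, eval_mul, eval_add,
    eval_pow, eval_C, hmap, hz, zero_mul, zero_add] at h3
  simp only [Polynomial.map_mul, Polynomial.map_pow, map_C, eval_mul, eval_pow, eval_C]
  rw [← h3, ← mul_assoc, sign_mul, sign_pos (a := f (q'.coeff k) ^ m * f (q'.coeff k) ^ m)
    (mul_self_pos.2 (pow_ne_zero _ hc)), one_mul]

end PseudoDivision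

section Table

variable (K L : Type) [Field K] [LinearOrder K] [IsStrictOrderedRing K] [IsRealClosed K]
  [Field L] [LinearOrder L] [IsStrictOrderedRing L] [IsRealClosed L]
  {R : Type} [CommRing R]

variable {K L} in
/-- The pairs of images of a set of polynomials under two homomorphisms. -/
def mapPairs (f : R →+* K) (f' : R →+* L) (G : Set R[X]) : Set (K[X] × L[X]) :=
  (fun g => (g.map f, g.map f')) '' G

/-- The finite set `F` of ring elements determines the sign table of the polynomials in `G`. -/
def Determines (F : Finset R) (G : Set R[X]) : Prop :=
  ∀ (f : R →+* K) (f' : R →+* L),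
    (∀ a ∈ F, SignType.sign (f a) = SignType.sign (f' a)) → ∃ S, IsTable (mapPairs f f' G) S

/-- The polynomials of T, of degree at most D, are added one at a time. The signs of p at roots of
the others are those of pseudo-remainders, which have degree below D and are moved into G. Hence G
is arbitrary in the induction on T, and `ih` covers it once T is empty. -/
theorem exists_determines_union {D : ℕ}
    (ih : ∀ G : Finset R[X], (∀ g ∈ G, g.degree < D) → ∃ F, Determines K L F (G : Set R[X]))
    (T : Finset R[X]) : ∀ G : Finset R[X], (∀ g ∈ T, g.degree < (D + 1 : ℕ)) →
      (∀ g ∈ G, g.degree < D) → ∃ F, Determines K L F (T ∪ G : Set R[X]) := by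
  classical
  induction T using Finset.induction_on with
  | empty =>
    intro G _ hG
    simpa using ih G hG
  | insert p T _ ihT =>
    intro G hT hG
    let Q : Finset R[X] := insert (derivative p) (T ∪ G)
    choose r hr1 hr2 using fun (q : R[X]) (k : ℕ) => exists_sign_remainder p q k
    -- The degree of the image of q is not known in advance, so a remainder is included for every k
    -- ≤ D.
    let G' : Finset R[X] := insert (derivative p) G ∪
      (Q ×ˢ Finset.range (D + 1)).image fun x => r x.1 x.2
    have hder : (derivative p).degree < D := by
      rw [degree_lt_iff_coeff_zero]
      intro i hi
      rw [coeff_derivative, (degree_lt_iff_coeff_zero _ _).1 (hT p (Finset.mem_insert_self _ _))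
        (i + 1) (by omega), zero_mul]
    have hG' : ∀ g ∈ G', g.degree < D := by
      intro g hg
      rcases Finset.mem_union.1 hg with hg | hg
      · rcases Finset.mem_insert.1 hg with rfl | hg
        · exact hder
        · exact hG g hg
      · obtain ⟨x, hx, rfl⟩ := Finset.mem_image.1 hg
        have := Finset.mem_range.1 (Finset.mem_product.1 hx).2
        exact (hr1 _ _).trans_le (by exact_mod_cast Nat.lt_succ_iff.1 this)
    have hQD : ∀ g ∈ Q, g.degree < (D + 1 : ℕ) := by
      have hlt : (D : WithBot ℕ) < (D + 1 : ℕ) := by exact_mod_cast D.lt_succ_self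
      intro g hg
      rcases Finset.mem_insert.1 hg with rfl | hg
      · exact hder.trans hlt
      rcases Finset.mem_union.1 hg with hg | hg
      · exact hT g (Finset.mem_insert_of_mem hg)
      · exact (hG g hg).trans hlt
    obtain ⟨F, hF⟩ := ihT G' (fun g hg => hT g (Finset.mem_insert_of_mem hg)) hG'
    -- With the signs of all coefficients fixed, the two images of each polynomial have the same
    -- degree and hence use the same remainder.
    refine ⟨F ∪ (insert p Q).biUnion fun g => g.coeffs, fun f f' hff' => ?_⟩
    have hco : ∀ g ∈ insert p Q, ∀ n,
        SignType.sign ((g.map f).coeff n) = SignType.sign ((g.map f').coeff n) := by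
      intro g hg n
      rw [coeff_map, coeff_map]
      by_cases h0 : g.coeff n = 0
      · rw [h0, map_zero f, map_zero f', sign_zero, sign_zero]
      · exact hff' _ (Finset.mem_union_right _ (Finset.mem_biUnion.2
          ⟨g, hg, coeff_mem_coeffs h0⟩))
    have hdeg : ∀ g ∈ insert p Q, (g.map f).degree = (g.map f').degree := fun g hg =>
      degree_eq_of_coeff_eq_zero_iff fun n => eq_zero_iff_of_sign_eq (hco g hg n)
    obtain ⟨S, hS⟩ := hF f f' fun a ha => hff' a (Finset.mem_union_left _ ha)
    have hQ : IsTable (mapPairs f f' (Q : Set R[X])) S := by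
      refine hS.subset (Set.image_mono fun g hg => ?_)
      simp only [Finset.coe_union, Finset.coe_insert, Q, G', Set.mem_union, Set.mem_insert_iff] at hg ⊢
      tauto
    have hstep := hQ.exists_insert (P := (p.map f, p.map f'))
      ⟨derivative p, Finset.mem_insert_self _ _, by rw [derivative_map, derivative_map]⟩
      (hco p (Finset.mem_insert_self _ _)) (by
        rintro _ ⟨g, hg, rfl⟩
        change g.map f = 0 ↔ g.map f' = 0
        rw [← degree_eq_bot, ← degree_eq_bot, hdeg g (Finset.mem_insert_of_mem hg)]) (by
        rintro s hs _ ⟨g, hg, rfl⟩ h0 hz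
        change g.map f ≠ 0 at h0
        change (g.map f).eval s.1 = 0 at hz
        have hk := degree_eq_natDegree h0
        have hz' : (g.map f').eval s.2 = 0 := (eq_zero_iff_of_sign_eq
          (hQ.sign _ _ (hQ.mono s hs) _ (Set.mem_image_of_mem _ hg))).1 hz
        have hk' := (hdeg g (Finset.mem_insert_of_mem hg)).symm.trans hk
        have hkD : (g.map f).natDegree < D + 1 := by
          have := (degree_map_le (f := f)).trans_lt (hQD g hg)
          rw [hk] at this
          exact_mod_cast this
        have hmem : r g (g.map f).natDegree ∈ (T ∪ G' : Set R[X]) := by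
          refine Or.inr (Finset.mem_coe.2 (Finset.mem_union_right _ (Finset.mem_image.2
            ⟨(g, (g.map f).natDegree), Finset.mem_product.2 ⟨hg, Finset.mem_range.2 hkD⟩, rfl⟩)))
        change SignType.sign ((p.map f).eval s.1) = SignType.sign ((p.map f').eval s.2)
        rw [hr2 _ _ f _ hk hz, hr2 _ _ f' _ hk' hz']
        exact hS.sign _ _ (hS.mono s hs) _ (Set.mem_image_of_mem _ hmem))
    obtain ⟨S', hS'⟩ := hstep
    refine ⟨S', hS'.subset ?_⟩
    rintro _ ⟨g, hg, rfl⟩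
    rw [Finset.coe_insert, Set.insert_union] at hg
    rcases hg with rfl | hg
    · exact Or.inl rfl
    · refine Or.inr (Set.mem_image_of_mem _ ?_)
      rw [Finset.mem_coe, Finset.mem_insert, Finset.mem_union]
      exact Or.inr hg

theorem exists_determines (G : Finset R[X]) : ∃ F, Determines K L F (G : Set R[X]) := by
  have key : ∀ (D : ℕ) (G : Finset R[X]), (∀ g ∈ G, g.degree < D) →
      ∃ F, Determines K L F (G : Set R[X]) := by
    intro D
    induction D with
    | zero =>
      intro G hG
      refine ⟨∅, fun f f' _ => ⟨∅, by simp, ?_, ?_, ?_⟩⟩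
      all_goals
        have h0 : ∀ g ∈ G, g = 0 := fun g hg =>
          degree_eq_bot.1 ((Nat.WithBot.lt_zero_iff).1 (by simpa using hG g hg))
      · rintro c d - _ ⟨g, hg, rfl⟩
        simp [h0 g hg]
      · rintro _ ⟨g, hg, rfl⟩ h
        simp [h0 g hg] at h
      · rintro _ ⟨g, hg, rfl⟩ h
        simp [h0 g hg] at h
    | succ D ih =>
      intro G hG
      simpa using exists_determines_union K L ih G ∅ hG (by simp)
  refine key (G.sup natDegree + 1) G fun g hg => degree_le_natDegree.trans_lt ?_
  exact_mod_cast Nat.lt_succ_iff.2 (Finset.le_sup (f := natDegree) hg)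

variable (R) in
/-- Every finite set of sign conditions satisfied by a homomorphism to `K` is satisfied by a
homomorphism to `L`. -/
def SignTransfer : Prop :=
  ∀ (G : Finset R) (f : R →+* K), ∃ f' : R →+* L,
    ∀ g ∈ G, SignType.sign (f g) = SignType.sign (f' g)

variable {K L}

/-- The coefficients are moved first, with the signs that determine a sign table. A point of L in
the same position as the image of X then extends the homomorphism. -/
theorem SignTransfer.polynomial (h : SignTransfer K L R) : SignTransfer K L R[X] := by
  intro G f
  obtain ⟨F, hF⟩ := exists_determines K L G
  obtain ⟨f', hf'⟩ := h F (f.comp C)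
  obtain ⟨S, hS⟩ := hF (f.comp C) f' hf'
  obtain ⟨d, hd⟩ := exists_match hS.mono (f X)
  refine ⟨eval₂RingHom f' d, fun g hg => ?_⟩
  have h1 := hS.sign _ _ hd _ (Set.mem_image_of_mem _ hg)
  have h2 : (g.map (f.comp C)).eval (f X) = f g := by
    rw [eval_map, ← hom_eval₂, eval₂_C_X]
  rw [coe_eval₂RingHom, ← eval_map, ← h2]
  exact h1

theorem SignTransfer.of_equiv {R' : Type} [CommRing R'] (h : SignTransfer K L R) (e : R ≃+* R') :
    SignTransfer K L R' := by
  classical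
  intro G f
  obtain ⟨f', hf'⟩ := h (G.image e.symm) (f.comp e)
  refine ⟨f'.comp e.symm, fun g hg => ?_⟩
  simpa using hf' _ (Finset.mem_image_of_mem _ hg)

theorem signTransfer_int : SignTransfer K L ℤ := by
  intro G f
  refine ⟨Int.castRingHom L, fun g _ => ?_⟩
  rw [eq_intCast, eq_intCast]
  rcases lt_trichotomy g 0 with h | rfl | h
  · rw [sign_neg (by exact_mod_cast h), sign_neg (by exact_mod_cast h)]
  · simp
  · rw [sign_pos (by exact_mod_cast h), sign_pos (by exact_mod_cast h)]

theorem signTransfer_mvPolynomial_fin (n : ℕ) :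
    SignTransfer K L (MvPolynomial (Fin n) ℤ) := by
  induction n with
  | zero => exact signTransfer_int.of_equiv (MvPolynomial.isEmptyRingEquiv ℤ (Fin 0)).symm
  | succ n ih => exact ih.polynomial.of_equiv (MvPolynomial.finSuccEquiv ℤ n).symm.toRingEquiv

theorem exists_sign_aeval_eq {σ : Type} (G : Finset (MvPolynomial σ ℤ)) (a : σ → K) :
    ∃ b : σ → L, ∀ g ∈ G,
      SignType.sign (MvPolynomial.aeval a g) = SignType.sign (MvPolynomial.aeval b g) := by
  classical
  -- Only finitely many variables occur, which reduces to `Fin n`; the remaining ones get the value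
  -- 0.
  let s : Finset σ := G.biUnion fun g => g.vars
  let e : Fin s.card → σ := fun i => (s.equivFin.symm i : σ)
  have he : Function.Injective e := Subtype.val_injective.comp s.equivFin.symm.injective
  have hG : ∀ g ∈ G, ∃ q, MvPolynomial.rename e q = g := fun g hg =>
    MvPolynomial.exists_rename_eq_of_vars_subset_range g e he fun x hx =>
      ⟨s.equivFin ⟨x, Finset.mem_biUnion.2 ⟨g, hg, hx⟩⟩, by simp [e]⟩
  choose! q hq using hG
  obtain ⟨f', hf'⟩ := signTransfer_mvPolynomial_fin (K := K) (L := L) s.card (G.image q)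
    (MvPolynomial.aeval (a ∘ e) : MvPolynomial (Fin s.card) ℤ →ₐ[ℤ] K).toRingHom
  let b : σ → L := Function.extend e (fun i => f' (MvPolynomial.X i)) 0
  refine ⟨b, fun g hg => ?_⟩
  have h1 := hf' _ (Finset.mem_image_of_mem _ hg)
  have h2 : f' = (MvPolynomial.aeval (b ∘ e) : MvPolynomial (Fin s.card) ℤ →ₐ[ℤ] L).toRingHom := by
    refine MvPolynomial.ringHom_ext (fun r => by simp) fun i => ?_
    simp [b, he.extend_apply]
  rw [h2] at h1
  rw [← hq g hg, MvPolynomial.aeval_rename, MvPolynomial.aeval_rename]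
  exact h1

end Table

end Transfer

/-! ### Models of RCOF as real closed ordered fields. -/

section Models

open FirstOrder FirstOrder.Language

variable (M : Type) [rLang.Structure M]

/-- The ring operations that a structure for the signature interprets. -/
abbrev mZero : M := Structure.funMap (L := rLang) RFunc.zero ![]
abbrev mOne : M := Structure.funMap (L := rLang) RFunc.one ![]

variable {M}

abbrev mNeg (a : M) : M := Structure.funMap (L := rLang) RFunc.neg ![a]
abbrev mAdd (a b : M) : M := Structure.funMap (L := rLang) RFunc.add ![a, b]
abbrev mMul (a b : M) : M := Structure.funMap (L := rLang) RFunc.mul ![a, b]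
abbrev mLt (a b : M) : Prop := Structure.RelMap (L := rLang) RRel.lt ![a, b]

section Realize

variable {V : Type} (v : V → M) (s t : RTerm V)

theorem realize_tZero : (tZero : RTerm V).realize v = mZero M := by
  unfold tZero Constants.term Term.realize
  congr 1
  exact Subsingleton.elim _ _

theorem realize_tOne : (tOne : RTerm V).realize v = mOne M := by
  unfold tOne Constants.term Term.realize
  congr 1
  exact Subsingleton.elim _ _

theorem realize_tNeg : (tNeg t).realize v = mNeg (t.realize v) :=
  Term.realize_functions_apply₁

theorem realize_tAdd : (tAdd s t).realize v = mAdd (s.realize v) (t.realize v) :=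
  Term.realize_functions_apply₂

theorem realize_tMul : (tMul s t).realize v = mMul (s.realize v) (t.realize v) :=
  Term.realize_functions_apply₂

theorem realize_bLt {n : ℕ} (s t : RTerm (V ⊕ Fin n)) (xs : Fin n → M) :
    (bLt s t).Realize v xs ↔
      mLt (s.realize (Sum.elim v xs)) (t.realize (Sum.elim v xs)) :=
  BoundedFormula.realize_rel₂

end Realize

section Axioms

variable [hM : M ⊨ rcof]

theorem realize_axiom (a : RAxiom) : M ⊨ a.toSentence :=
  hM.realize_of_mem _ ⟨a, rfl⟩

theorem m_axioms :
    (∀ a b c : M, mAdd (mAdd a b) c = mAdd a (mAdd b c)) ∧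
    (∀ a b : M, mAdd a b = mAdd b a) ∧
    (∀ a : M, mAdd (mZero M) a = a) ∧
    (∀ a : M, mAdd (mNeg a) a = mZero M) ∧
    (∀ a b c : M, mMul (mMul a b) c = mMul a (mMul b c)) ∧
    (∀ a b : M, mMul a b = mMul b a) ∧
    (∀ a : M, mMul (mOne M) a = a) ∧
    (∀ a b c : M, mMul a (mAdd b c) = mAdd (mMul a b) (mMul a c)) ∧
    (∀ a : M, a ≠ mZero M → ∃ b, mMul a b = mOne M) ∧
    (mZero M ≠ mOne M) := by
  refine ⟨?_, ?_, ?_, ?_, ?_, ?_, ?_, ?_, ?_, ?_⟩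
  · simpa [RAxiom.toSentence, Sentence.Realize, Formula.Realize, realize_tAdd, Fin.snoc]
      using realize_axiom (M := M) .addAssoc
  · simpa [RAxiom.toSentence, Sentence.Realize, Formula.Realize, realize_tAdd, Fin.snoc]
      using realize_axiom (M := M) .addComm
  · simpa [RAxiom.toSentence, Sentence.Realize, Formula.Realize, realize_tAdd, realize_tZero,
      Fin.snoc] using realize_axiom (M := M) .zeroAdd
  · simpa [RAxiom.toSentence, Sentence.Realize, Formula.Realize, realize_tAdd, realize_tZero,
      realize_tNeg, Fin.snoc] using realize_axiom (M := M) .negAdd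
  · simpa [RAxiom.toSentence, Sentence.Realize, Formula.Realize, realize_tMul, Fin.snoc]
      using realize_axiom (M := M) .mulAssoc
  · simpa [RAxiom.toSentence, Sentence.Realize, Formula.Realize, realize_tMul, Fin.snoc]
      using realize_axiom (M := M) .mulComm
  · simpa [RAxiom.toSentence, Sentence.Realize, Formula.Realize, realize_tMul, realize_tOne,
      Fin.snoc] using realize_axiom (M := M) .oneMul
  · simpa [RAxiom.toSentence, Sentence.Realize, Formula.Realize, realize_tMul, realize_tAdd,
      Fin.snoc] using realize_axiom (M := M) .leftDistrib
  · simpa [RAxiom.toSentence, Sentence.Realize, Formula.Realize, realize_tMul, realize_tZero,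
      realize_tOne, Fin.snoc] using realize_axiom (M := M) .existsInv
  · simpa [RAxiom.toSentence, Sentence.Realize, Formula.Realize, realize_tZero,
      realize_tOne, Fin.snoc] using realize_axiom (M := M) .zeroNeOne

theorem m_order_axioms :
    (∀ a : M, ¬ mLt a a) ∧
    (∀ a b c : M, mLt a b → mLt b c → mLt a c) ∧
    (∀ a b : M, mLt a b ∨ a = b ∨ mLt b a) ∧
    (∀ a b c : M, mLt a b → mLt (mAdd a c) (mAdd b c)) ∧
    (∀ a b : M, mLt (mZero M) a → mLt (mZero M) b → mLt (mZero M) (mMul a b)) ∧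
    (∀ a : M, mLt (mZero M) a → ∃ b, mMul b b = a) := by
  refine ⟨?_, ?_, ?_, ?_, ?_, ?_⟩
  · simpa [RAxiom.toSentence, Sentence.Realize, Formula.Realize, realize_bLt, Fin.snoc]
      using realize_axiom (M := M) .ltIrrefl
  · simpa [RAxiom.toSentence, Sentence.Realize, Formula.Realize, realize_bLt, Fin.snoc]
      using realize_axiom (M := M) .ltTrans
  · simpa [RAxiom.toSentence, Sentence.Realize, Formula.Realize, realize_bLt, Fin.snoc]
      using realize_axiom (M := M) .ltTotal
  · simpa [RAxiom.toSentence, Sentence.Realize, Formula.Realize, realize_bLt, realize_tAdd,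
      Fin.snoc] using realize_axiom (M := M) .addLt
  · simpa [RAxiom.toSentence, Sentence.Realize, Formula.Realize, realize_bLt, realize_tMul,
      realize_tZero, Fin.snoc] using realize_axiom (M := M) .mulPos
  · simpa [RAxiom.toSentence, Sentence.Realize, Formula.Realize, realize_bLt, realize_tMul,
      realize_tZero, Fin.snoc] using realize_axiom (M := M) .sqrt

variable (M) in
/-- The additive group underlying a model. -/
noncomputable abbrev modelAddCommGroup : AddCommGroup M :=
  letI : Zero M := ⟨mZero M⟩
  letI : Add M := ⟨mAdd⟩
  letI : Neg M := ⟨mNeg⟩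
  { AddGroup.ofLeftAxioms (G := M) m_axioms.1 m_axioms.2.2.1 m_axioms.2.2.2.1 with
    add_comm := m_axioms.2.1 }

theorem mMul_zero (a : M) : mMul a (mZero M) = mZero M := by
  let _ := modelAddCommGroup M
  have h : mMul a (mAdd (mZero M) (mZero M)) = mAdd (mMul a (mZero M)) (mMul a (mZero M)) :=
    m_axioms.2.2.2.2.2.2.2.1 a _ _
  rw [m_axioms.2.2.1] at h
  exact left_eq_add.1 h

variable (M) in
/-- The commutative ring underlying a model. -/
noncomputable abbrev modelCommRing : CommRing M :=
  letI := modelAddCommGroup M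
  letI : Mul M := ⟨mMul⟩
  letI : One M := ⟨mOne M⟩
  { modelAddCommGroup M with
    mul_assoc := m_axioms.2.2.2.2.1
    mul_comm := m_axioms.2.2.2.2.2.1
    one_mul := m_axioms.2.2.2.2.2.2.1
    mul_one := fun a => (m_axioms.2.2.2.2.2.1 a _).trans (m_axioms.2.2.2.2.2.2.1 a)
    left_distrib := m_axioms.2.2.2.2.2.2.2.1
    right_distrib := fun a b c =>
      ((m_axioms.2.2.2.2.2.1 _ _).trans (m_axioms.2.2.2.2.2.2.2.1 c a b)).trans
        (congrArg₂ mAdd (m_axioms.2.2.2.2.2.1 _ _) (m_axioms.2.2.2.2.2.1 _ _))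
    zero_mul := fun a => (m_axioms.2.2.2.2.2.1 _ a).trans (mMul_zero a)
    mul_zero := mMul_zero }

variable (M) in
/-- The field underlying a model. -/
noncomputable abbrev modelField : Field M :=
  let _ := modelCommRing M
  IsField.toField (R := M)
    { exists_pair_ne := ⟨0, 1, m_axioms.2.2.2.2.2.2.2.2.2⟩
      mul_comm := mul_comm
      mul_inv_cancel := fun {a} ha => m_axioms.2.2.2.2.2.2.2.2.1 a ha }

open Classical in
variable (M) in
/-- The linear order underlying a model. -/
noncomputable abbrev modelLinearOrder : LinearOrder M :=
  have : IsStrictTotalOrder M mLt :=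
    { irrefl := m_order_axioms.1
      trans := m_order_axioms.2.1
      trichotomous := fun a b h1 h2 => by
        rcases m_order_axioms.2.2.1 a b with h | h | h
        · exact absurd h h1
        · exact h
        · exact absurd h h2 }
  linearOrderOfSTO mLt

theorem model_isStrictOrderedRing :
    letI := modelField M
    letI := modelLinearOrder M
    IsStrictOrderedRing M := by
  let _ := modelField M
  let _ := modelLinearOrder M
  have hadd : ∀ a b c : M, a < b → a + c < b + c := m_order_axioms.2.2.2.1
  have hmul : ∀ a b : M, 0 < a → 0 < b → 0 < a * b := m_order_axioms.2.2.2.2.1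
  have : IsOrderedAddMonoid M :=
    { add_le_add_left := fun a b h c => by
        rcases h.eq_or_lt with rfl | h
        · exact le_rfl
        · exact (hadd a b c h).le }
  -- The axioms do not state 0 < 1. If 1 < 0, then −1 is positive, and so is its square 1.
  have : ZeroLEOneClass M := ⟨by
    by_contra h
    have h1 : (0 : M) < -1 := by
      have := hadd 1 0 (-1) (not_le.1 h)
      simpa using this
    have h2 := hmul _ _ h1 h1
    rw [neg_mul_neg, one_mul] at h2
    exact h h2.le⟩
  exact IsStrictOrderedRing.of_mul_pos hmul

theorem realize_tPow {V : Type} (v : V → M) (t : RTerm V) (n : ℕ) :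
    letI := modelField M
    (tPow t n).realize v = t.realize v ^ n := by
  let _ := modelField M
  induction n with
  | zero => rw [pow_zero]; exact realize_tOne v
  | succ n ih => rw [pow_succ, tPow, realize_tMul, ih]; rfl

theorem realize_tListSum {V : Type} (v : V → M) (l : List (RTerm V)) :
    letI := modelField M
    (tListSum l).realize v = (l.map fun t => t.realize v).sum := by
  let _ := modelField M
  induction l with
  | nil => exact realize_tZero v
  | cons t l ih =>
    rw [List.map_cons, List.sum_cons, ← ih]
    exact realize_tAdd v _ _

theorem model_exists_odd_root (n : ℕ) (xs : Fin (2 * n + 1) → M) :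
    letI := modelField M
    ∃ y : M, y ^ (2 * n + 1) + ∑ i, xs i * y ^ (i : ℕ) = 0 := by
  let _ := modelField M
  have h := realize_axiom (M := M) (.oddRoot n)
  rw [RAxiom.toSentence, Sentence.Realize, BoundedFormula.realize_alls] at h
  obtain ⟨y, hy⟩ := BoundedFormula.realize_ex.1 (h xs)
  refine ⟨y, ?_⟩
  rw [BoundedFormula.realize_bdEqual, realize_tAdd, realize_tPow, realize_tZero,
    realize_tListSum, List.map_map] at hy
  have h1 : ((List.finRange (2 * n + 1)).map ((fun t => Term.realize
      (Sum.elim (default : Empty → M) (Fin.snoc xs y : Fin (2 * n + 1 + 1) → M)) t) ∘ fun (i : Fin (2 * n + 1)) =>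
        tMul (&(i.castSucc)) (tPow (&(Fin.last (2 * n + 1))) i))).sum
      = ∑ i, xs i * y ^ (i : ℕ) := by
    rw [← List.ofFn_eq_map, List.sum_ofFn]
    refine Finset.sum_congr rfl fun i _ => ?_
    rw [Function.comp_apply, realize_tMul, realize_tPow]
    simp only [Function.comp_apply, Term.realize_var, Sum.elim_inr, Fin.snoc_castSucc, Fin.snoc_last]
    rfl
  rw [← h1]
  simp only [Function.comp_apply, Term.realize_var, Sum.elim_inr, Fin.snoc_last] at hy
  exact hy

open Polynomial in
theorem model_isRealClosed :
    letI := modelField M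
    IsRealClosed M := by
  let _ := modelField M
  let _ := modelLinearOrder M
  have := model_isStrictOrderedRing (M := M)
  refine IsRealClosed.of_linearOrderedField (fun {x} hx => ?_) fun {f} hf => ?_
  · rcases hx.eq_or_lt with rfl | hx
    · exact IsSquare.zero
    · obtain ⟨b, hb⟩ := m_order_axioms.2.2.2.2.2 x hx
      exact ⟨b, hb.symm⟩
  · obtain ⟨n, hn⟩ := hf
    have hf0 : f ≠ 0 := by rintro rfl; simp at hn
    have hl := leadingCoeff_ne_zero.2 hf0
    -- The axiom is about monic polynomials, so f is divided by its leading coefficient.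
    obtain ⟨y, hy⟩ := model_exists_odd_root n fun i : Fin (2 * n + 1) =>
      f.coeff i / f.leadingCoeff
    refine ⟨y, ?_⟩
    rw [IsRoot, eval_eq_sum_range, hn, Finset.sum_range_succ, ← hn, coeff_natDegree, hn,
      Finset.sum_range]
    have h1 : ∑ i : Fin (2 * n + 1), f.coeff i * y ^ (i : ℕ)
        = f.leadingCoeff * ∑ i : Fin (2 * n + 1), f.coeff i / f.leadingCoeff * y ^ (i : ℕ) := by
      rw [Finset.mul_sum]
      refine Finset.sum_congr rfl fun i _ => ?_
      rw [← mul_assoc, mul_div_cancel₀ _ hl]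
    rw [h1]
    linear_combination f.leadingCoeff * hy

end Axioms

end Models

/-! ### Transfer of quantifier-free formulas to the reals. -/

section RealTransfer

open FirstOrder FirstOrder.Language

/-- The signature is interpreted by the operations and the order of the field. -/
structure IsOrderedFieldStructure (K : Type) [Field K] [LinearOrder K] [rLang.Structure K] :
    Prop where
  zero : mZero K = 0
  one : mOne K = 1
  neg : ∀ a : K, mNeg a = -a
  add : ∀ a b : K, mAdd a b = a + b
  mul : ∀ a b : K, mMul a b = a * b
  lt : ∀ a b : K, mLt a b ↔ a < b

theorem isOrderedFieldStructure_real : IsOrderedFieldStructure ℝ :=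
  ⟨rfl, rfl, fun _ => rfl, fun _ _ => rfl, fun _ _ => rfl, fun _ _ => Iff.rfl⟩

/-- The polynomial is chosen before the field, so that the same one serves a model and ℝ. -/
theorem exists_poly_of_term {V : Type} (t : RTerm V) : ∃ p : MvPolynomial V ℤ,
    ∀ {K : Type} [Field K] [LinearOrder K] [rLang.Structure K], IsOrderedFieldStructure K →
      ∀ v : V → K, t.realize v = MvPolynomial.aeval v p := by
  induction t with
  | var x => exact ⟨MvPolynomial.X x, fun _ v => by simp⟩
  | @func n f ts ih =>
    choose p hp using ih
    cases f with
    | zero =>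
      refine ⟨0, fun {K} _ _ _ h v => ?_⟩
      rw [map_zero, ← h.zero]
      change Structure.funMap (L := rLang) RFunc.zero (fun i => (ts i).realize v) = _
      congr 1
      exact Subsingleton.elim _ _
    | one =>
      refine ⟨1, fun {K} _ _ _ h v => ?_⟩
      rw [map_one, ← h.one]
      change Structure.funMap (L := rLang) RFunc.one (fun i => (ts i).realize v) = _
      congr 1
      exact Subsingleton.elim _ _
    | neg =>
      refine ⟨-p 0, fun {K} _ _ _ h v => ?_⟩
      rw [map_neg, ← h.neg, ← hp 0 h v]
      change Structure.funMap (L := rLang) RFunc.neg (fun i => (ts i).realize v) = _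
      congr 1
      funext i
      fin_cases i
      rfl
    | add =>
      refine ⟨p 0 + p 1, fun {K} _ _ _ h v => ?_⟩
      rw [map_add, ← h.add, ← hp 0 h v, ← hp 1 h v]
      change Structure.funMap (L := rLang) RFunc.add (fun i => (ts i).realize v) = _
      congr 1
      funext i
      fin_cases i <;> rfl
    | mul =>
      refine ⟨p 0 * p 1, fun {K} _ _ _ h v => ?_⟩
      rw [map_mul, ← h.mul, ← hp 0 h v, ← hp 1 h v]
      change Structure.funMap (L := rLang) RFunc.mul (fun i => (ts i).realize v) = _
      congr 1
      funext i
      fin_cases i <;> rfl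

/-- Each atomic formula is a condition on the sign of a difference of two terms. These differences,
collected independently of the fields, decide the formula. -/
theorem exists_finset_of_isQF {V : Type} {n : ℕ} {f : rLang.BoundedFormula V n} (hf : f.IsQF) :
    ∃ G : Finset (MvPolynomial (V ⊕ Fin n) ℤ),
      ∀ {K L : Type} [Field K] [LinearOrder K] [IsStrictOrderedRing K] [rLang.Structure K]
        [Field L] [LinearOrder L] [IsStrictOrderedRing L] [rLang.Structure L],
        IsOrderedFieldStructure K → IsOrderedFieldStructure L →
        ∀ (v : V → K) (xs : Fin n → K) (w : V → L) (ys : Fin n → L),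
        (∀ g ∈ G, SignType.sign (MvPolynomial.aeval (Sum.elim v xs) g)
          = SignType.sign (MvPolynomial.aeval (Sum.elim w ys) g)) →
        (f.Realize v xs ↔ f.Realize w ys) := by
  classical
  induction hf with
  | falsum => exact ⟨∅, fun _ _ _ _ _ _ _ => Iff.rfl⟩
  | imp _ _ ih1 ih2 =>
    obtain ⟨G1, h1⟩ := ih1
    obtain ⟨G2, h2⟩ := ih2
    refine ⟨G1 ∪ G2, fun hK hL v xs w ys h => ?_⟩
    rw [BoundedFormula.realize_imp, BoundedFormula.realize_imp,
      h1 hK hL v xs w ys fun g hg => h g (Finset.mem_union_left _ hg),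
      h2 hK hL v xs w ys fun g hg => h g (Finset.mem_union_right _ hg)]
  | of_isAtomic hat =>
    cases hat with
    | equal t1 t2 =>
      obtain ⟨p1, hp1⟩ := exists_poly_of_term t1
      obtain ⟨p2, hp2⟩ := exists_poly_of_term t2
      refine ⟨{p1 - p2}, fun hK hL v xs w ys h => ?_⟩
      have h0 := h _ (Finset.mem_singleton_self _)
      rw [map_sub (MvPolynomial.aeval _), map_sub (MvPolynomial.aeval _), ← hp1 hK, ← hp2 hK,
        ← hp1 hL, ← hp2 hL] at h0
      rw [BoundedFormula.realize_bdEqual, BoundedFormula.realize_bdEqual, ← sub_eq_zero,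
        eq_zero_iff_of_sign_eq h0, sub_eq_zero]
    | @rel l R ts =>
      cases R with
      | lt =>
        obtain ⟨p1, hp1⟩ := exists_poly_of_term (ts 0)
        obtain ⟨p2, hp2⟩ := exists_poly_of_term (ts 1)
        refine ⟨{p2 - p1}, fun {K L} _ _ _ _ _ _ _ _ hK hL v xs w ys h => ?_⟩
        have h0 := h _ (Finset.mem_singleton_self _)
        rw [map_sub (MvPolynomial.aeval _), map_sub (MvPolynomial.aeval _), ← hp1 hK, ← hp2 hK,
          ← hp1 hL, ← hp2 hL] at h0
        have key : ∀ {N : Type} [Field N] [LinearOrder N] [IsStrictOrderedRing N]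
            [rLang.Structure N] (_ : IsOrderedFieldStructure N) (u : V → N) (zs : Fin n → N),
            (Relations.boundedFormula (L := rLang) RRel.lt ts).Realize u zs ↔
              SignType.sign ((ts 1).realize (Sum.elim u zs) - (ts 0).realize (Sum.elim u zs))
                = 1 := by
          intro N _ _ _ _ hN u zs
          rw [sign_eq_one_iff, sub_pos, ← hN.lt]
          change Structure.RelMap (L := rLang) RRel.lt
            (fun i => (ts i).realize (Sum.elim u zs)) ↔ _
          refine iff_of_eq (congrArg _ (funext fun i => ?_))
          fin_cases i <;> rfl
        rw [key hK, key hL, h0]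

open Polynomial in
-- A polynomial of odd degree has opposite signs far to the left and far to the right, and
-- continuity gives a root.
theorem isRealClosed_real : IsRealClosed ℝ := by
  refine IsRealClosed.of_linearOrderedField (fun hx => ⟨_, (Real.mul_self_sqrt hx).symm⟩) fun {f} hf => ?_
  have hf0 : f ≠ 0 := by rintro rfl; simp at hf
  obtain ⟨M, hM⟩ := exists_forall_ge_sign_eval hf0
  obtain ⟨N, hN⟩ := exists_forall_le_sign_eval hf0
  have h1 := hM M le_rfl
  have h2 := hN N le_rfl
  rw [hf.neg_one_pow] at h2
  rcases (leadingCoeff_ne_zero.2 hf0).lt_or_gt with h | h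
  · rw [sign_neg h, sign_eq_neg_one_iff] at h1
    rw [sign_neg h, show (-1 : SignType) * -1 = 1 from rfl, sign_eq_one_iff] at h2
    exact mem_range_of_exists_le_of_exists_ge f.continuous ⟨M, h1.le⟩ ⟨N, h2.le⟩
  · rw [sign_pos h, sign_eq_one_iff] at h1
    rw [sign_pos h, one_mul, sign_eq_neg_one_iff] at h2
    exact mem_range_of_exists_le_of_exists_ge f.continuous ⟨N, h2.le⟩ ⟨M, h1.le⟩

/-- A counterexample in a model would have a real point with the same signs of the relevant
polynomials, hence a real counterexample. -/
theorem isRcofTheorem_of_forall_real {f : rLang.Formula Var} (hf : BoundedFormula.IsQF f)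
    (h : ∀ ρ : Var → ℝ, f.Realize ρ) : IsRcofTheorem f := by
  intro M v xs
  have hR := isRealClosed_real
  have hmod : (M : Type) ⊨ rcof := M.is_model
  let _ := modelField M
  let _ := modelLinearOrder M
  have := model_isStrictOrderedRing (M := M)
  have := model_isRealClosed (M := M)
  have hM : IsOrderedFieldStructure M :=
    ⟨rfl, rfl, fun _ => rfl, fun _ _ => rfl, fun _ _ => rfl, fun _ _ => Iff.rfl⟩
  obtain ⟨G, hG⟩ := exists_finset_of_isQF hf
  obtain ⟨b, hb⟩ := exists_sign_aeval_eq (L := ℝ) G (Sum.elim v xs)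
  rw [hG hM isOrderedFieldStructure_real v xs (b ∘ Sum.inl) (b ∘ Sum.inr)
    (by rwa [Sum.elim_comp_inl_inr])]
  have h1 := h (b ∘ Sum.inl)
  rw [Formula.Realize] at h1
  convert h1

section QuantifierFree

variable {V : Type}

theorem isQF_foldr_inf {l : List (rLang.Formula V)} (h : ∀ f ∈ l, BoundedFormula.IsQF f) :
    BoundedFormula.IsQF (l.foldr (· ⊓ ·) ⊤) := by
  induction l with
  | nil => exact BoundedFormula.IsQF.top
  | cons f l ih =>
    exact (h f List.mem_cons_self).inf (ih fun g hg => h g (List.mem_cons_of_mem _ hg))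

theorem isQF_iInf {β : Type} [Finite β] {f : β → rLang.Formula V}
    (h : ∀ b, BoundedFormula.IsQF (f b)) : BoundedFormula.IsQF (Formula.iInf f) := by
  refine isQF_foldr_inf fun g hg => ?_
  obtain ⟨b, -, rfl⟩ := List.mem_map.1 hg
  exact h b

theorem isQF_equal (s t : RTerm V) : BoundedFormula.IsQF (Term.equal s t) :=
  (BoundedFormula.IsAtomic.equal _ _).isQF

theorem isQF_fLt (s t : RTerm V) : BoundedFormula.IsQF (fLt s t) :=
  (BoundedFormula.IsAtomic.rel _ _).isQF

theorem isQF_fLe (s t : RTerm V) : BoundedFormula.IsQF (fLe s t) :=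
  (isQF_fLt s t).sup (isQF_equal s t)

theorem isQF_qObs (A : Finset ℕ) : BoundedFormula.IsQF (qObs A) :=
  isQF_iInf fun _ => isQF_equal _ _

theorem isQF_qForm (A : Finset ℕ) (D : Finset CForm) : BoundedFormula.IsQF (qForm A D) :=
  (isQF_iInf fun _ => (isQF_fLe _ _).inf (isQF_fLe _ _)).inf
    ((isQF_equal _ _).inf ((isQF_iInf fun _ => isQF_iInf fun _ => isQF_equal _ _).inf
      ((isQF_iInf fun _ => isQF_fLe _ _).inf (isQF_iInf fun _ => isQF_equal _ _))))

theorem PForm.isQF_toRcof (g : PForm) : BoundedFormula.IsQF g.toRcof := by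
  induction g with
  | obs a => exact isQF_qObs _
  | prob a c p =>
    cases c with
    | eq => exact (isQF_qObs _).inf (isQF_equal _ _)
    | lt => exact (isQF_qObs _).inf (isQF_fLt _ _)
  | imp f g ihf ihg => exact ihf.imp ihg

theorem PForm.isQF_rrCondition (bs : List PForm) (b : PForm) :
    BoundedFormula.IsQF (PForm.rrCondition bs b) := by
  refine ((isQF_qForm _ _).inf (isQF_foldr_inf fun f hf => ?_)).imp b.isQF_toRcof
  obtain ⟨g, -, rfl⟩ := List.mem_map.1 hf
  exact g.isQF_toRcof

end QuantifierFree

end RealTransfer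

/-! ### Projections as propositional quantum variables. -/

section ProjectionPQV

open MeasureTheory
open scoped InnerProductSpace

variable {H : Type} [NormedAddCommGroup H] [InnerProductSpace ℂ H] [CompleteSpace H]

/-- A bounded operator as an everywhere defined partial operator. -/
noncomputable def fullOp (P : H →L[ℂ] H) : H →ₗ.[ℂ] H := (P : H →ₗ[ℂ] H).toPMap ⊤

theorem fullOp_isSelfAdjoint {P : H →L[ℂ] H} (hP : IsSelfAdjoint P) :
    IsSelfAdjoint (fullOp P) := by
  have h := ContinuousLinearMap.toPMap_adjoint_eq_adjoint_toPMap_of_dense P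
    (p := ⊤) (by simp)
  rw [← ContinuousLinearMap.star_eq_adjoint, hP.star_eq] at h
  exact h

theorem one_mem_realSpectrum {P : H →L[ℂ] H} (hP : IsIdempotentElem P) (h0 : P ≠ 0) :
    (1 : ℝ) ∈ realSpectrum (fullOp P) := by
  intro hb
  apply h0
  ext ξ
  have h1 : P (P ξ) = P ξ := congrArg (fun T : H →L[ℂ] H => T ξ) hP.eq
  have := hb.1 (a₁ := ⟨P ξ, trivial⟩) (a₂ := 0) (by
    change P (P ξ) - ((1 : ℝ) : ℂ) • P ξ = P 0 - ((1 : ℝ) : ℂ) • (0 : H)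
    simp [h1])
  exact congrArg Subtype.val this

theorem zero_mem_realSpectrum {P : H →L[ℂ] H} (hP : IsIdempotentElem P) (h1 : P ≠ 1) :
    (0 : ℝ) ∈ realSpectrum (fullOp P) := by
  intro hb
  apply h1
  ext ξ
  have h2 : P (P ξ) = P ξ := congrArg (fun T : H →L[ℂ] H => T ξ) hP.eq
  have := hb.1 (a₁ := ⟨P ξ, trivial⟩) (a₂ := ⟨ξ, trivial⟩) (by
    change P (P ξ) - ((0 : ℝ) : ℂ) • P ξ = P ξ - ((0 : ℝ) : ℂ) • ξ
    simp [h2])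
  exact congrArg Subtype.val this

/-- Countable additivity of a point mass: `q` singles out at most one point, which lies in at most
one of the disjoint sets. -/
theorem hasSum_ite_iUnion {Ω E : Type} [AddCommMonoid E] [TopologicalSpace E] {S : ℕ → Set Ω}
    (hd : Pairwise (Function.onFun Disjoint S)) (p : Set Ω → Prop)
    (hp : ∃ q : Ω → Prop, (∀ x y, q x → q y → x = y) ∧ ∀ s, p s ↔ ∃ x ∈ s, q x)
    [∀ s, Decidable (p s)] (v : E) :
    HasSum (fun j => if p (S j) then v else 0) (if p (⋃ j, S j) then v else 0) := by
  obtain ⟨q, hq, hpq⟩ := hp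
  by_cases h : p (⋃ j, S j)
  · rw [if_pos h]
    obtain ⟨x, hx, hqx⟩ := (hpq _).1 h
    obtain ⟨j, hj⟩ := Set.mem_iUnion.1 hx
    have h1 := hasSum_single (f := fun j => if p (S j) then v else 0) j fun i hi => by
      refine if_neg fun h' => ?_
      obtain ⟨y, hy, hqy⟩ := (hpq _).1 h'
      rw [hq y x hqy hqx] at hy
      exact Set.disjoint_left.1 (hd hi) hy hj
    rwa [if_pos ((hpq _).2 ⟨x, hj, hqx⟩)] at h1
  · rw [if_neg h]
    have h1 : ∀ j, ¬ p (S j) := fun j h' => by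
      obtain ⟨y, hy, hqy⟩ := (hpq _).1 h'
      exact h ((hpq _).2 ⟨y, Set.mem_iUnion.2 ⟨j, hy⟩, hqy⟩)
    simp [h1]

open Classical in
/-- The value on `S` of the spectral measure of the projection `P`. -/
noncomputable def specProj (P : H →L[ℂ] H) (S : Set (realSpectrum (fullOp P))) : H →L[ℂ] H :=
  (if ∃ x ∈ S, (x : ℝ) = 1 then P else 0) + (if ∃ x ∈ S, (x : ℝ) = 0 then 1 - P else 0)

/-- If 1 is not in the spectrum then P = 0, and if 0 is not then P = 1. In either case the
corresponding summand is zero, so degenerate projections need no separate treatment later. -/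
theorem specProj_eq {P : H →L[ℂ] H} (hP : IsIdempotentElem P)
    (S : Set (realSpectrum (fullOp P))) (p q : Prop) [Decidable p] [Decidable q]
    (hp : ∀ x : realSpectrum (fullOp P), (x : ℝ) = 1 → (x ∈ S ↔ p))
    (hq : ∀ x : realSpectrum (fullOp P), (x : ℝ) = 0 → (x ∈ S ↔ q)) :
    specProj P S = (if p then P else 0) + (if q then 1 - P else 0) := by
  rw [specProj]
  congr 1
  · by_cases h : P = 0
    · simp [h]
    let x : realSpectrum (fullOp P) := ⟨1, one_mem_realSpectrum hP h⟩
    have : (∃ x ∈ S, (x : ℝ) = 1) ↔ p :=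
      ⟨fun ⟨y, hy, h1⟩ => (hp y h1).1 hy, fun h => ⟨x, (hp x rfl).2 h, rfl⟩⟩
    simp only [this]
  · by_cases h : P = 1
    · simp [h]
    let x : realSpectrum (fullOp P) := ⟨0, zero_mem_realSpectrum hP h⟩
    have : (∃ x ∈ S, (x : ℝ) = 0) ↔ q :=
      ⟨fun ⟨y, hy, h1⟩ => (hq y h1).1 hy, fun h => ⟨x, (hq x rfl).2 h, rfl⟩⟩
    simp only [this]

/-- The spectral measure of a projection. -/
noncomputable def projPVM {P : H →L[ℂ] H} (hP : IsStarProjection P) :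
    PVM H (realSpectrum (fullOp P)) where
  proj := specProj P
  isStarProjection S _ := by
    rw [specProj]
    split_ifs
    · rw [add_sub_cancel]
      exact IsStarProjection.one _
    · rwa [add_zero]
    · rw [zero_add]
      exact hP.one_sub
    · rw [add_zero]
      exact IsStarProjection.zero _
  proj_empty := by simp [specProj]
  proj_univ := by
    rw [specProj_eq hP.isIdempotentElem Set.univ True True (by simp) (by simp)]
    simp
  proj_iUnion S _ hd ξ := by
    classical
    have h1 := hasSum_ite_iUnion hd (fun s => ∃ x ∈ s, (x : ℝ) = 1)
      ⟨fun x => (x : ℝ) = 1, fun x y hx hy => Subtype.ext (hx.trans hy.symm), fun s => Iff.rfl⟩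
      (P ξ)
    have h2 := hasSum_ite_iUnion hd (fun s => ∃ x ∈ s, (x : ℝ) = 0)
      ⟨fun x => (x : ℝ) = 0, fun x y hx hy => Subtype.ext (hx.trans hy.symm), fun s => Iff.rfl⟩
      ((1 - P) ξ)
    have key : ∀ s, specProj P s ξ = (if ∃ x ∈ s, (x : ℝ) = 1 then P ξ else 0) +
        (if ∃ x ∈ s, (x : ℝ) = 0 then (1 - P) ξ else 0) := by
      intro s
      rw [specProj]
      split_ifs <;> simp
    simp only [key]
    exact h1.add h2
  proj_inter S T _ _ := by
    classical
    have hi : P * P = P := hP.isIdempotentElem.eq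
    have h1 := specProj_eq hP.isIdempotentElem (S ∩ T)
      ((∃ x ∈ S, (x : ℝ) = 1) ∧ ∃ x ∈ T, (x : ℝ) = 1)
      ((∃ x ∈ S, (x : ℝ) = 0) ∧ ∃ x ∈ T, (x : ℝ) = 0)
      (fun x hx => ⟨fun h => ⟨⟨x, h.1, hx⟩, ⟨x, h.2, hx⟩⟩, fun ⟨⟨y, hy, hy1⟩, ⟨z, hz, hz1⟩⟩ => by
        rw [Subtype.ext (hy1.trans hx.symm)] at hy
        rw [Subtype.ext (hz1.trans hx.symm)] at hz
        exact ⟨hy, hz⟩⟩)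
      (fun x hx => ⟨fun h => ⟨⟨x, h.1, hx⟩, ⟨x, h.2, hx⟩⟩, fun ⟨⟨y, hy, hy1⟩, ⟨z, hz, hz1⟩⟩ => by
        rw [Subtype.ext (hy1.trans hx.symm)] at hy
        rw [Subtype.ext (hz1.trans hx.symm)] at hz
        exact ⟨hy, hz⟩⟩)
    rw [h1, specProj, specProj]
    by_cases a : ∃ x ∈ S, (x : ℝ) = 1 <;> by_cases b : ∃ x ∈ T, (x : ℝ) = 1 <;>
      by_cases c : ∃ x ∈ S, (x : ℝ) = 0 <;> by_cases d : ∃ x ∈ T, (x : ℝ) = 0 <;>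
      simp only [a, b, c, d, and_self, and_true, and_false, if_true, if_false] <;>
      simp [mul_sub, sub_mul, hi]

theorem measurableSet_val_eq {s : Set ℝ} (r : ℝ) : MeasurableSet {x : s | (x : ℝ) = r} :=
  measurable_subtype_coe (measurableSet_singleton r)

theorem measure_apply {P : H →L[ℂ] H} (hP : IsStarProjection P) (ξ : H)
    {S : Set (realSpectrum (fullOp P))} (hS : MeasurableSet S) :
    (projPVM hP).measure ξ S = ENNReal.ofReal (⟪ξ, specProj P S ξ⟫_ℂ).re :=
  Measure.ofMeasurable_apply S hS

theorem ae_eq_zero_or_one {P : H →L[ℂ] H} (hP : IsStarProjection P) (ξ : H) :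
    ∀ᵐ x : realSpectrum (fullOp P) ∂((projPVM hP).measure ξ), (x : ℝ) = 0 ∨ (x : ℝ) = 1 := by
  rw [ae_iff]
  have hm : MeasurableSet {x : realSpectrum (fullOp P) | ¬ ((x : ℝ) = 0 ∨ (x : ℝ) = 1)} :=
    ((measurableSet_val_eq 0).union (measurableSet_val_eq 1)).compl
  rw [measure_apply hP ξ hm, specProj_eq hP.isIdempotentElem _ False False
    (fun x hx => by simp [hx]) (fun x hx => by simp [hx])]
  simp

theorem measure_univ_lt_top {P : H →L[ℂ] H} (hP : IsStarProjection P) (ξ : H) :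
    (projPVM hP).measure ξ Set.univ < ⊤ := by
  rw [measure_apply hP ξ MeasurableSet.univ]
  exact ENNReal.ofReal_lt_top

theorem isSpectralMeasure_projPVM {P : H →L[ℂ] H} (hP : IsStarProjection P) :
    IsSpectralMeasure (fullOp P) (projPVM hP) where
  mem_domain_iff ξ := by
    refine iff_of_true trivial ?_
    refine lt_of_le_of_lt (lintegral_mono_ae (g := fun _ => 1) ?_) ?_
    · filter_upwards [ae_eq_zero_or_one hP ξ] with x hx
      rcases hx with hx | hx <;> simp [hx]
    · rw [lintegral_one]
      exact measure_univ_lt_top hP ξ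
  inner_apply ξ := by
    -- The measure is concentrated on 0 and 1, so the integral of the identity is the mass of the
    -- value 1.
    have h1 : ∫ x, (x : ℝ) ∂((projPVM hP).measure (ξ : H))
        = ((projPVM hP).measure (ξ : H)).real {x : realSpectrum (fullOp P) | (x : ℝ) = 1} := by
      rw [← integral_indicator_one (measurableSet_val_eq 1)]
      refine integral_congr_ae ?_
      filter_upwards [ae_eq_zero_or_one hP (ξ : H)] with x hx
      rcases hx with hx | hx <;> simp [Set.indicator, hx]
    have h2 : specProj P {x : realSpectrum (fullOp P) | (x : ℝ) = 1} = P := by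
      rw [specProj_eq hP.isIdempotentElem _ True False (fun x hx => by simp [hx])
        (fun x hx => by simp [hx])]
      simp
    have hn := (projPVM hP).inner_eq_norm_sq (measurableSet_val_eq 1) (ξ : H)
    change (⟪(ξ : H), specProj P {x : realSpectrum (fullOp P) | (x : ℝ) = 1} ξ⟫_ℂ).re
      = ‖specProj P {x : realSpectrum (fullOp P) | (x : ℝ) = 1} ξ‖ ^ 2 at hn
    rw [h2] at hn
    rw [h1, Measure.real, measure_apply hP _ (measurableSet_val_eq 1), h2,
      ENNReal.toReal_ofReal (by rw [hn]; positivity)]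
    change ⟪(ξ : H), P ξ⟫_ℂ = _
    refine Complex.ext (Complex.ofReal_re _).symm ?_
    rw [Complex.ofReal_im]
    exact hP.isSelfAdjoint.isSymmetric.im_inner_self_apply (ξ : H)

/-- The quantum variable given by a projection and the value `1`. -/
noncomputable def projPQV {P : H →L[ℂ] H} (hP : IsStarProjection P) : PQV H where
  op := fullOp P
  isSelfAdjoint := fullOp_isSelfAdjoint hP.isSelfAdjoint
  spectral := projPVM hP
  isSpectralMeasure := isSpectralMeasure_projPVM hP
  up := {x : realSpectrum (fullOp P) | (x : ℝ) = 1}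
  measurableSet_up := measurableSet_val_eq 1

theorem projPQV_proj {P : H →L[ℂ] H} (hP : IsStarProjection P) (b : Bool) :
    (projPQV hP).proj b = if b then P else 1 - P := by
  cases b
  · change specProj P {x : realSpectrum (fullOp P) | (x : ℝ) = 1}ᶜ = 1 - P
    rw [specProj_eq hP.isIdempotentElem _ False True (fun x hx => by simp [hx])
      (fun x hx => by simp [hx])]
    simp
  · change specProj P {x : realSpectrum (fullOp P) | (x : ℝ) = 1} = P
    rw [specProj_eq hP.isIdempotentElem _ True False (fun x hx => by simp [hx])
      (fun x hx => by simp [hx])]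
    simp

end ProjectionPQV

/-! ### Block diagonal projections on a finite-dimensional space. -/

section BlockStructure

open scoped InnerProductSpace

variable {ι : Type} [Fintype ι] [DecidableEq ι]

/-- The block diagonal operator with the given two by two blocks. -/
noncomputable def blockOp (M : ι → Matrix (Fin 2) (Fin 2) ℂ) :
    EuclideanSpace ℂ (Fin 2 × ι) →L[ℂ] EuclideanSpace ℂ (Fin 2 × ι) :=
  Matrix.toEuclideanCLM (𝕜 := ℂ) (Matrix.blockDiagonal M)

theorem blockOp_apply (M : ι → Matrix (Fin 2) (Fin 2) ℂ) (x : EuclideanSpace ℂ (Fin 2 × ι))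
    (k : Fin 2) (i : ι) : blockOp M x (k, i) = ∑ l, M i k l * x (l, i) := by
  have h : blockOp M x (k, i) = ∑ p, Matrix.blockDiagonal M (k, i) p * x p := rfl
  rw [h, Fintype.sum_prod_type]
  refine Finset.sum_congr rfl fun l _ => ?_
  simp [Matrix.blockDiagonal_apply]

theorem isStarProjection_blockOp {M : ι → Matrix (Fin 2) (Fin 2) ℂ}
    (hM : ∀ i, IsStarProjection (M i)) : IsStarProjection (blockOp M) := by
  have h : IsStarProjection (Matrix.blockDiagonal M) := by
    refine ⟨?_, ?_⟩
    · rw [IsIdempotentElem, ← Matrix.blockDiagonal_mul]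
      congr 1
      funext i
      exact (hM i).isIdempotentElem.eq
    · rw [isSelfAdjoint_iff, Matrix.star_eq_conjTranspose, Matrix.blockDiagonal_conjTranspose]
      congr 1
      funext i
      exact (hM i).isSelfAdjoint.star_eq
  exact h.map (Matrix.toEuclideanCLM (𝕜 := ℂ) (n := Fin 2 × ι))

theorem commute_blockOp_iff {M N : ι → Matrix (Fin 2) (Fin 2) ℂ} :
    Commute (blockOp M) (blockOp N) ↔ ∀ i, Commute (M i) (N i) := by
  rw [commute_iff_eq, blockOp, blockOp, ← map_mul, ← map_mul,
    EmbeddingLike.apply_eq_iff_eq,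
    ← Matrix.blockDiagonal_mul, ← Matrix.blockDiagonal_mul,
    Matrix.blockDiagonal_injective.eq_iff, funext_iff]
  rfl

theorem isStarProjection_diag :
    IsStarProjection (!![1, 0; 0, 0] : Matrix (Fin 2) (Fin 2) ℂ) := by
  refine ⟨?_, ?_⟩
  · rw [IsIdempotentElem]
    ext i j
    fin_cases i <;> fin_cases j <;> simp [Matrix.mul_apply]
  · rw [isSelfAdjoint_iff, Matrix.star_eq_conjTranspose]
    ext i j
    fin_cases i <;> fin_cases j <;> simp

theorem isStarProjection_half :
    IsStarProjection (!![1 / 2, 1 / 2; 1 / 2, 1 / 2] : Matrix (Fin 2) (Fin 2) ℂ) := by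
  refine ⟨?_, ?_⟩
  · rw [IsIdempotentElem]
    ext i j
    fin_cases i <;> fin_cases j <;> simp [Matrix.mul_apply] <;> norm_num
  · rw [isSelfAdjoint_iff, Matrix.star_eq_conjTranspose]
    ext i j
    fin_cases i <;> fin_cases j <;> simp

theorem not_commute_diag_half : ¬ Commute (!![1, 0; 0, 0] : Matrix (Fin 2) (Fin 2) ℂ)
    !![1 / 2, 1 / 2; 1 / 2, 1 / 2] := by
  intro h
  have := congrFun (congrFun h.eq 0) 1
  simp [Matrix.mul_apply] at this

/-- The quantum structure whose variables are given by block diagonal projections. -/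
noncomputable def blockStructure (M : ℕ → ι → Matrix (Fin 2) (Fin 2) ℂ)
    (hM : ∀ j i, IsStarProjection (M j i)) (ψ : EuclideanSpace ℂ (Fin 2 × ι)) (hψ : ‖ψ‖ = 1) :
    QStructure (EuclideanSpace ℂ (Fin 2 × ι)) where
  state := ψ
  norm_state := hψ
  var j := projPQV (isStarProjection_blockOp (hM j))

section

variable {M : ℕ → ι → Matrix (Fin 2) (Fin 2) ℂ} (hM : ∀ j i, IsStarProjection (M j i))

theorem projPQV_blockOp_apply_of_scalar (j : ℕ) (b c : Bool)
    (x : EuclideanSpace ℂ (Fin 2 × ι)) (k : Fin 2) (i : ι) (h : M j i = if c then 1 else 0) :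
    (projPQV (isStarProjection_blockOp (hM j))).proj b x (k, i)
      = if c = b then x (k, i) else 0 := by
  have h1 : blockOp (M j) x (k, i) = if c then x (k, i) else 0 := by
    rw [blockOp_apply, h]
    cases c
    · simp
    · simp [Matrix.one_apply]
  rw [projPQV_proj]
  cases b <;> cases c <;> simp [h1]

theorem projPQV_blockOp_apply_of_zero (j : ℕ) (b : Bool) (x : EuclideanSpace ℂ (Fin 2 × ι))
    (k : Fin 2) (i : ι) (hx : ∀ l, x (l, i) = 0) :
    (projPQV (isStarProjection_blockOp (hM j))).proj b x (k, i) = 0 := by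
  have h1 : blockOp (M j) x (k, i) = 0 := by
    rw [blockOp_apply]
    simp [hx]
  rw [projPQV_proj]
  cases b <;> simp [h1, hx]

/-- Each block either carries no part of ψ, and then neither does any image of ψ, or all projections
act on it as the scalars 0 and 1 encoded by `V i`. So the order of the factors is irrelevant on ψ
even when they do not commute, and a block survives exactly when its valuation agrees with U on the
list. -/
theorem prod_proj_apply (U : Finset ℕ) (V : ι → Finset ℕ) (ψ : EuclideanSpace ℂ (Fin 2 × ι))
    (hV : ∀ i, (∀ k, ψ (k, i) = 0) ∨ ∀ j, M j i = if j ∈ V i then 1 else 0) (l : List ℕ)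
    (k : Fin 2) (i : ι) :
    ((l.map fun j => (projPQV (isStarProjection_blockOp (hM j))).proj (decide (j ∈ U))).prod ψ)
      (k, i) = if ∀ j ∈ l, (j ∈ V i ↔ j ∈ U) then ψ (k, i) else 0 := by
  rcases hV i with h0 | h0
  · rw [h0, ite_self]
    induction l generalizing k with
    | nil => exact h0 k
    | cons j l ih =>
      rw [List.map_cons, List.prod_cons, mul_apply_eq_comp]
      exact projPQV_blockOp_apply_of_zero hM j _ _ k i ih
  · induction l with
    | nil => simp
    | cons j l ih =>
      rw [List.map_cons, List.prod_cons, mul_apply_eq_comp,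
        projPQV_blockOp_apply_of_scalar hM j _ (decide (j ∈ V i)) _ k i (by rw [h0 j]; simp), ih]
      by_cases h : j ∈ V i ↔ j ∈ U
      · have h2 : decide (j ∈ V i) = decide (j ∈ U) := by simp [h]
        rw [if_pos h2]
        simp [h]
      · have h2 : decide (j ∈ V i) ≠ decide (j ∈ U) := by simpa using h
        rw [if_neg h2]
        simp [h]

theorem jointProb_blockStructure (A U : Finset ℕ) (V : ι → Finset ℕ)
    (ψ : EuclideanSpace ℂ (Fin 2 × ι)) (hψ : ‖ψ‖ = 1)
    (hV : ∀ i, (∀ k, ψ (k, i) = 0) ∨ ∀ j, M j i = if j ∈ V i then 1 else 0) :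
    (blockStructure M hM ψ hψ).jointProb A U
      = ∑ i, if ∀ j ∈ A, (j ∈ V i ↔ j ∈ U) then ∑ k, ‖ψ (k, i)‖ ^ 2 else 0 := by
  rw [QStructure.jointProb]
  change (⟪ψ, (((A.sort (· ≤ ·)).reverse.map fun j =>
    (projPQV (isStarProjection_blockOp (hM j))).proj (decide (j ∈ U))).prod) ψ⟫_ℂ).re = _
  rw [PiLp.inner_apply, Complex.re_sum, Fintype.sum_prod_type_right]
  refine Finset.sum_congr rfl fun i _ => ?_
  split_ifs with h
  · refine Finset.sum_congr rfl fun k _ => ?_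
    rw [prod_proj_apply hM U V ψ hV, if_pos (by simpa using h), inner_self_eq_norm_sq_to_K]
    norm_cast
  · refine Finset.sum_eq_zero fun k _ => ?_
    rw [prod_proj_apply hM U V ψ hV, if_neg (by simpa using h), inner_zero_right, Complex.zero_re]

theorem compatible_blockStructure_iff (ψ : EuclideanSpace ℂ (Fin 2 × ι)) (hψ : ‖ψ‖ = 1)
    (a b : ℕ) : ((blockStructure M hM ψ hψ).var a).Compatible ((blockStructure M hM ψ hψ).var b) ↔
      ∀ i, Commute (M a i) (M b i) := by
  rw [← commute_blockOp_iff, PQV.Compatible]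
  change Commute ((projPQV (isStarProjection_blockOp (hM a))).proj true)
    ((projPQV (isStarProjection_blockOp (hM b))).proj true) ↔ _
  rw [projPQV_proj, projPQV_proj]
  rfl

end

end BlockStructure

/-! ### Quantum structures with prescribed probabilities and incompatibilities. -/

section Existence

/-- The block that makes the two symbols of `e` incompatible. -/
noncomputable def pairBlock (e : Finset ℕ) (j : ℕ) : Matrix (Fin 2) (Fin 2) ℂ :=
  if j ∈ e then
    if ∀ k ∈ e, j ≤ k then !![1, 0; 0, 0] else !![1 / 2, 1 / 2; 1 / 2, 1 / 2]
  else 0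

theorem isStarProjection_pairBlock (e : Finset ℕ) (j : ℕ) :
    IsStarProjection (pairBlock e j) := by
  rw [pairBlock]
  split_ifs
  · exact isStarProjection_diag
  · exact isStarProjection_half
  · exact IsStarProjection.zero _

theorem not_commute_pairBlock {a b : ℕ} (h : a ≠ b) :
    ¬ Commute (pairBlock {a, b} a) (pairBlock {a, b} b) := by
  have key : ∀ {a b : ℕ}, a < b → ¬ Commute (pairBlock {a, b} a) (pairBlock {a, b} b) := by
    intro a b h
    have h1 : pairBlock {a, b} a = !![1, 0; 0, 0] := by
      rw [pairBlock, if_pos (by simp), if_pos (by simp [h.le])]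
    have h2 : pairBlock {a, b} b = !![1 / 2, 1 / 2; 1 / 2, 1 / 2] := by
      rw [pairBlock, if_pos (by simp), if_neg (by simp [h])]
    rw [h1, h2]
    exact not_commute_diag_half
  rcases h.lt_or_gt with h | h
  · exact key h
  · rw [Finset.pair_comm]
    exact fun h' => key h h'.symm

/-- Given a probability distribution on the valuations on `A` and a set of incompatible pairs,
there is a quantum structure with these joint probabilities where exactly these pairs are
incompatible. -/
theorem exists_quantum_structure (A : Finset ℕ) (μ : Finset ℕ → ℝ)
    (hμ : ∀ U ∈ A.powerset, 0 ≤ μ U) (hsum : ∑ U ∈ A.powerset, μ U = 1)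
    (inc : Finset ℕ → Prop) :
    ∃ (ι : Type) (_ : Fintype ι) (I : QStructure (EuclideanSpace ℂ ι)),
      (∀ A' U : Finset ℕ, I.jointProb A' U
        = ∑ V ∈ A.powerset with ∀ j ∈ A', (j ∈ V ↔ j ∈ U), μ V) ∧
      ∀ a ∈ A, ∀ b ∈ A, (I.var a).Compatible (I.var b) ↔ (a ≠ b → ¬ inc {a, b}) := by
  classical
  -- One scalar block for each valuation carries the probabilities; one block for each pair of
  -- symbols carries its possible incompatibility.
  let ι := A.powerset ⊕ A.powersetCard 2
  let M : ℕ → ι → Matrix (Fin 2) (Fin 2) ℂ := fun j => Sum.elim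
    (fun U => if j ∈ U.1 then 1 else 0) (fun e => if inc e.1 then pairBlock e.1 j else 0)
  have hM : ∀ j i, IsStarProjection (M j i) := by
    rintro j (U | e)
    · change IsStarProjection (if j ∈ U.1 then 1 else 0)
      split_ifs
      · exact IsStarProjection.one _
      · exact IsStarProjection.zero _
    · change IsStarProjection (if inc e.1 then pairBlock e.1 j else 0)
      split_ifs
      · exact isStarProjection_pairBlock _ _
      · exact IsStarProjection.zero _
  -- The amplitude on a valuation block is the square root of its weight; the pair blocks are
  -- outside the support of the state.
  let ψ : EuclideanSpace ℂ (Fin 2 × ι) := WithLp.toLp 2 fun p =>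
    if p.1 = 0 then Sum.elim (fun U : A.powerset => ((√(μ U.1) : ℝ) : ℂ)) (fun _ => 0) p.2 else 0
  have hl : ∀ U : A.powerset, ∑ k, ‖ψ (k, Sum.inl U)‖ ^ 2 = μ U.1 := by
    intro U
    rw [Fin.sum_univ_two]
    have h0 : ψ (0, Sum.inl U) = ((√(μ U.1) : ℝ) : ℂ) := rfl
    have h1 : ψ (1, Sum.inl U) = 0 := rfl
    rw [h0, h1, Complex.norm_real, Real.norm_eq_abs, sq_abs, Real.sq_sqrt (hμ _ U.2)]
    simp
  have hr : ∀ (e : A.powersetCard 2) (k), ψ (k, Sum.inr e) = 0 := by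
    intro e k
    fin_cases k <;> rfl
  have hψ : ‖ψ‖ = 1 := by
    rw [EuclideanSpace.norm_eq, Real.sqrt_eq_one, Fintype.sum_prod_type_right,
      Fintype.sum_sum_type]
    simp only [hl, hr]
    rw [← hsum, ← Finset.sum_coe_sort A.powerset μ]
    simp
  refine ⟨Fin 2 × ι, inferInstance, blockStructure M hM ψ hψ, fun A' U => ?_, fun a ha b hb => ?_⟩
  · rw [jointProb_blockStructure hM A' U (Sum.elim (fun V => V.1) fun _ => ∅) ψ hψ,
      Fintype.sum_sum_type]
    · simp only [hl, hr, Sum.elim_inl]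
      rw [Finset.sum_filter, ← Finset.sum_coe_sort A.powerset]
      simp
    · rintro (V | e)
      · exact Or.inr fun j => rfl
      · exact Or.inl (hr e)
  · rw [compatible_blockStructure_iff]
    constructor
    · intro h hab hinc
      let e : A.powersetCard 2 := ⟨{a, b}, Finset.mem_powersetCard.2
        ⟨by simp [Finset.insert_subset_iff, ha, hb], Finset.card_pair hab⟩⟩
      have h1 := h (Sum.inr e)
      change Commute (if inc {a, b} then pairBlock {a, b} a else 0)
        (if inc {a, b} then pairBlock {a, b} b else 0) at h1
      rw [if_pos hinc, if_pos hinc] at h1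
      exact not_commute_pairBlock hab h1
    · rintro h (U | e)
      · change Commute (if a ∈ U.1 then 1 else 0) _
        split_ifs
        · exact Commute.one_left _
        · exact Commute.zero_left _
      · rcases eq_or_ne a b with rfl | hab
        · exact Commute.refl _
        change Commute (if inc e.1 then pairBlock e.1 a else 0)
          (if inc e.1 then pairBlock e.1 b else 0)
        split_ifs with hinc
        -- On a pair block only the two symbols of that pair act nontrivially, so a and b fail to
        -- commute there only if e is {a, b}.
        · by_cases hae : a ∈ e.1
          · by_cases hbe : b ∈ e.1
            · refine absurd ?_ (h hab)
              have : ({a, b} : Finset ℕ) = e.1 := Finset.eq_of_subset_of_card_le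
                (by simp [Finset.insert_subset_iff, hae, hbe])
                (by rw [Finset.card_pair hab, (Finset.mem_powersetCard.1 e.2).2])
              rwa [this]
            · rw [pairBlock.eq_def e.1 b, if_neg hbe]
              exact Commute.zero_right _
          · rw [pairBlock.eq_def e.1 a, if_neg hae]
            exact Commute.zero_left _
        · exact Commute.zero_left _

end Existence

/-! ### Real solutions of Q^{A,Δ} as quantum structures. -/

section Completeness

open FirstOrder FirstOrder.Language

section RealSemantics

variable {V : Type} (v : V → ℝ)

theorem realize_tZero_real : (tZero : RTerm V).realize v = 0 := realize_tZero v

theorem realize_tOne_real : (tOne : RTerm V).realize v = 1 := realize_tOne v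

theorem realize_tListSum_real (l : List (RTerm V)) :
    (tListSum l).realize v = (l.map fun t => t.realize v).sum := by
  induction l with
  | nil => exact realize_tZero_real v
  | cons t l ih =>
    rw [List.map_cons, List.sum_cons, ← ih]
    exact realize_tAdd v _ _

theorem realize_tSum_real {ι : Type} (s : Finset ι) (f : ι → RTerm V) :
    (tSum s f).realize v = ∑ i ∈ s, (f i).realize v := by
  rw [tSum, realize_tListSum_real, List.map_map, ← Finset.sum_map_toList]
  rfl

theorem realize_fLt_real (s t : RTerm V) : (fLt s t).Realize v ↔ s.realize v < t.realize v :=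
  Formula.realize_rel₂

theorem realize_fLe_real (s t : RTerm V) : (fLe s t).Realize v ↔ s.realize v ≤ t.realize v := by
  rw [fLe, Formula.realize_sup, realize_fLt_real, Formula.realize_equal, le_iff_lt_or_eq]

theorem realize_foldr_inf_real (l : List (rLang.Formula V)) :
    Formula.Realize (l.foldr (· ⊓ ·) ⊤) v ↔ ∀ f ∈ l, Formula.Realize f v := by
  induction l with
  | nil => simp [Formula.Realize]
  | cons f l ih => rw [List.foldr_cons, Formula.realize_inf, ih, List.forall_mem_cons]

theorem realize_qObs {ρ : Var → ℝ} {A : Finset ℕ} : (qObs A).Realize ρ ↔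
    ∀ e (he : e.card = 2), e ⊆ A → ρ (Var.pair ⟨e, he⟩) = 0 := by
  rw [qObs, Formula.realize_iInf]
  simp only [Formula.realize_equal, realize_tZero_real]
  constructor
  · intro h e he heA
    exact h ⟨e, Finset.mem_powersetCard.2 ⟨heA, he⟩⟩
  · intro h e
    exact h e.1 (Finset.mem_powersetCard.1 e.2).2 (Finset.mem_powersetCard.1 e.2).1

theorem qForm_consequences {ρ : Var → ℝ} {A : Finset ℕ} {D : Finset CForm}
    (h : (qForm A D).Realize ρ) :
    (∀ U ∈ A.powerset, 0 ≤ ρ (.form (CForm.valForm A U))) ∧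
    ∑ U ∈ A.powerset, ρ (.form (CForm.valForm A U)) = 1 ∧
    (∀ A' ⊆ A, ∀ U' ⊆ A', ρ (.form (CForm.valForm A' U'))
      = ∑ U ∈ A.powerset with U ∩ A' = U', ρ (.form (CForm.valForm A U))) ∧
    ∀ a ∈ D, ρ (.form a) = ∑ U ∈ a.satVals, ρ (.form (CForm.valForm a.syms U)) := by
  simp only [qForm, Formula.realize_inf, Formula.realize_iInf, realize_fLe_real,
    Formula.realize_equal, realize_tZero_real, realize_tOne_real, realize_tSum_real] at h
  obtain ⟨h1, h2, h3, -, h5⟩ := h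
  refine ⟨fun U hU => (h1 ⟨U, hU⟩).1, h2, fun A' hA' U' hU' => ?_, fun a ha => h5 ⟨a, ha⟩⟩
  exact h3 ⟨A', Finset.mem_powerset.2 hA'⟩ ⟨U', Finset.mem_powerset.2 hU'⟩

end RealSemantics

theorem CForm.essSyms_subset (a : CForm) : a.essSyms ⊆ a.syms := by
  classical
  exact Finset.filter_subset _ _

/-- A real solution of `Q^{A,Δ}` is realized by a quantum structure. -/
theorem exists_structure_of_realize_qForm {ρ : Var → ℝ} {A : Finset ℕ} {D : Finset CForm}
    (h : (qForm A D).Realize ρ) :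
    ∃ (ι : Type) (_ : Fintype ι) (I : QStructure (EuclideanSpace ℂ ι)),
      ∀ g : PForm, g.syms ⊆ A → g.probArgs ⊆ D → (I.Sat ρ g ↔ g.toRcof.Realize ρ) := by
  obtain ⟨h1, h2, h3, h4⟩ := qForm_consequences h
  obtain ⟨ι, hι, I, hjoint, hcomp⟩ := exists_quantum_structure A _ h1 h2
    -- A pair is incompatible when its variable is nonzero, to match `qObs`.
    fun e => ∃ he : e.card = 2, ρ (.pair ⟨e, he⟩) ≠ 0
  refine ⟨ι, hι, I, ?_⟩
  have hobs : ∀ a : CForm, a.syms ⊆ A → (I.Observable a ↔ (qObs a.essSyms).Realize ρ) := by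
    intro a ha
    have hess := a.essSyms_subset.trans ha
    rw [realize_qObs]
    constructor
    · intro ho e he hea
      obtain ⟨x, y, hxy, rfl⟩ := Finset.card_eq_two.1 he
      have hx : x ∈ a.essSyms := hea (by simp)
      have hy : y ∈ a.essSyms := hea (by simp)
      by_contra hne
      exact (hcomp x (hess hx) y (hess hy)).1 (ho x hx y hy) hxy ⟨he, hne⟩
    · intro hq x hx y hy
      refine (hcomp x (hess hx) y (hess hy)).2 ?_
      rintro - ⟨he, hne⟩
      exact hne (hq _ he (by simp [Finset.insert_subset_iff, hx, hy]))
  have hprob : ∀ a ∈ D, a.syms ⊆ A → I.formProb a = ρ (.form a) := by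
    intro a ha haA
    rw [QStructure.formProb, h4 a ha]
    refine Finset.sum_congr rfl fun U hU => ?_
    have hUs := Finset.mem_powerset.1 (Finset.mem_filter.1 hU).1
    -- The joint probability is a marginal of the distribution on A, which the marginal equation
    -- identifies with the variable of the smaller valuation formula.
    rw [hjoint, h3 a.syms haA U hUs]
    refine Finset.sum_congr (Finset.filter_congr fun W _ => ?_) fun _ _ => rfl
    constructor
    · intro hW
      ext j
      rw [Finset.mem_inter]
      exact ⟨fun hj => (hW j hj.2).1 hj.1, fun hj => ⟨(hW j (hUs hj)).2 hj, hUs hj⟩⟩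
    · rintro rfl j hj
      rw [Finset.mem_inter]
      exact ⟨fun h => ⟨h, hj⟩, fun h => h.1⟩
  intro g
  induction g with
  | obs a =>
    intro hs _
    exact hobs a hs
  | prob a c p =>
    intro hs hD
    have ha := hprob a (hD (Finset.mem_singleton_self a)) hs
    cases c with
    | eq =>
      rw [PForm.toRcof, Formula.realize_inf, Formula.realize_equal, ← hobs a hs,
        QStructure.Sat, ha]
      rfl
    | lt =>
      rw [PForm.toRcof, Formula.realize_inf, realize_fLt_real, ← hobs a hs,
        QStructure.Sat, ha]
      rfl
  | imp f g ihf ihg =>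
    intro hs hD
    rw [PForm.toRcof, Formula.realize_imp, QStructure.Sat,
      ihf (Finset.union_subset_left hs) (Finset.union_subset_left hD),
      ihg (Finset.union_subset_right hs) (Finset.union_subset_right hD), imp_iff_not_or]

/-! ### Propositional reduction to valid clauses of literals. -/

section Propositional

variable {H : Type} [NormedAddCommGroup H] [InnerProductSpace ℂ H] [CompleteSpace H]

theorem QStructure.formProb_verum (I : QStructure H) : I.formProb CForm.verum = 1 := by
  have h : CForm.verum.satVals = {∅} := by
    simp [CForm.satVals, CForm.syms, CForm.eval]
  rw [QStructure.formProb, h, Finset.sum_singleton, QStructure.jointProb]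
  simp [CForm.syms, I.norm_state]

theorem QStructure.not_sat_falsum (I : QStructure H) (ρ : Var → ℝ) :
    ¬ I.Sat ρ PForm.falsum := by
  rintro ⟨-, h⟩
  rw [I.formProb_verum] at h
  simp only [Term.realize_relabel, realize_tOne_real, lt_irrefl] at h

theorem QStructure.sat_iff_propEval (I : QStructure H) (ρ : Var → ℝ) (g : PForm) :
    I.Sat ρ g ↔ g.propEval (I.Sat ρ) := by
  induction g with
  | obs a => exact Iff.rfl
  | prob a c p => exact Iff.rfl
  | imp f g ihf ihg => rw [QStructure.Sat, PForm.propEval, ihf, ihg, imp_iff_not_or]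

namespace PForm

variable {e : PForm → Prop}

theorem propEval_neg (he : ¬ e falsum) (f : PForm) : (neg f).propEval e ↔ ¬ f.propEval e :=
  ⟨fun h hf => he (h hf), fun h hf => absurd hf h⟩

theorem propEval_conj (he : ¬ e falsum) (f g : PForm) :
    (conj f g).propEval e ↔ f.propEval e ∧ g.propEval e := by
  rw [conj, propEval_neg he, propEval, propEval_neg he]
  tauto

theorem propEval_foldl_conj (he : ¬ e falsum) (l : List PForm) (f : PForm) :
    (l.foldl conj f).propEval e ↔ f.propEval e ∧ ∀ g ∈ l, g.propEval e := by
  induction l generalizing f with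
  | nil => simp
  | cons g l ih => rw [List.foldl_cons, ih, propEval_conj he, and_assoc, List.forall_mem_cons]

theorem propEval_clause (he : ¬ e falsum) (l : List PForm) (g : PForm) :
    (clause l g).propEval e ↔ ((∀ f ∈ l, f.propEval e) → g.propEval e) := by
  cases l with
  | nil => simp [clause]
  | cons f l => rw [clause, propEval, propEval_foldl_conj he, List.forall_mem_cons]

theorem subset_foldl_conj {β : Type} [DecidableEq β] (s : PForm → Finset β)
    (hs : ∀ f g, s (imp f g) = s f ∪ s g) (l : List PForm) (f : PForm) :
    s f ⊆ s (l.foldl conj f) ∧ ∀ g ∈ l, s g ⊆ s (l.foldl conj f) := by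
  induction l generalizing f with
  | nil => simp
  | cons g l ih =>
    have hc : s f ⊆ s (conj f g) ∧ s g ⊆ s (conj f g) := by
      simp only [conj, neg, hs]
      constructor <;> intro x hx <;> simp [hx]
    have h1 := ih (conj f g)
    rw [List.foldl_cons, List.forall_mem_cons]
    exact ⟨hc.1.trans h1.1, hc.2.trans h1.1, h1.2⟩

theorem subset_clause {β : Type} [DecidableEq β] (s : PForm → Finset β)
    (hs : ∀ f g, s (imp f g) = s f ∪ s g) (l : List PForm) (g : PForm) :
    (∀ f ∈ l, s f ⊆ s (clause l g)) ∧ s g ⊆ s (clause l g) := by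
  cases l with
  | nil => simp [clause]
  | cons f l =>
    have h := subset_foldl_conj s hs l f
    rw [clause, hs, List.forall_mem_cons]
    exact ⟨⟨h.1.trans Finset.subset_union_left, fun f' hf' =>
      (h.2 f' hf').trans Finset.subset_union_left⟩, Finset.subset_union_right⟩

/-- A real point satisfying Q^{A,Δ} and the premises is realized by a quantum structure where the
premises hold; validity gives the conclusion there, and it translates back to the point. The symbols
and probability arguments of every literal lie among those of the whole clause, as the realization
requires. -/
theorem isRcofTheorem_rrCondition_of_valid {bs : List PForm} {b : PForm}
    (h : Valid (clause bs b)) : IsRcofTheorem (rrCondition bs b) := by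
  refine isRcofTheorem_of_forall_real (isQF_rrCondition bs b) fun ρ => ?_
  rw [rrCondition, Formula.realize_imp, Formula.realize_inf, realize_foldr_inf_real]
  rintro ⟨hq, hbs⟩
  obtain ⟨ι, _, I, hI⟩ := exists_structure_of_realize_qForm hq
  have hsyms := subset_clause syms (fun _ _ => rfl) bs b
  have hargs := subset_clause probArgs (fun _ _ => rfl) bs b
  rw [← hI b hsyms.2 hargs.2, I.sat_iff_propEval]
  have hc := (I.sat_iff_propEval ρ _).1 (h _ I ρ)
  rw [propEval_clause (I.not_sat_falsum ρ)] at hc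
  refine hc fun f hf => ?_
  rw [← I.sat_iff_propEval, hI f (hsyms.1 f hf) (hargs.1 f hf)]
  exact hbs _ (List.mem_map_of_mem hf)

theorem derivable_clause_of_valid {bs : List PForm} {b : PForm} (hbs : ∀ f ∈ bs, f.IsLiteral)
    (hb : b.IsLiteral) (h : Valid (clause bs b)) : Derivable (clause bs b) :=
  Derivable.RR bs b hbs hb (isRcofTheorem_rrCondition_of_valid h)

/-- The nested implication from all hypotheses to `f` is tautological; modus ponens discharges them
one by one. -/
theorem derivable_of_tautological_consequence {l : List PForm} (hl : ∀ g ∈ l, Derivable g)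
    {f : PForm} (h : ∀ e : PForm → Prop, (∀ g ∈ l, g.propEval e) → f.propEval e) :
    Derivable f := by
  induction l generalizing f with
  | nil => exact Derivable.TT f fun e => h e (by simp)
  | cons g l ih =>
    rw [List.forall_mem_cons] at hl
    exact Derivable.MP g f hl.1 (ih hl.2 fun e he hg => h e (List.forall_mem_cons.2 ⟨hg, he⟩))

/-- The atoms that occur in a formula. -/
def atoms : PForm → List PForm
  | obs a => [obs a]
  | prob a c p => [prob a c p]
  | imp f g => f.atoms ++ g.atoms

theorem isAtom_of_mem_atoms {f a : PForm} (h : a ∈ f.atoms) : a.IsAtom := by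
  induction f with
  | obs b => rw [List.mem_singleton.1 h]; exact .obs b
  | prob b c p => rw [List.mem_singleton.1 h]; exact .prob b c p
  | imp f g ihf ihg => exact (List.mem_append.1 h).elim ihf ihg

theorem IsAtom.propEval_iff {a : PForm} (h : a.IsAtom) : a.propEval e ↔ e a := by
  cases h <;> exact Iff.rfl

theorem propEval_congr {e' : PForm → Prop} {f : PForm} (h : ∀ a ∈ f.atoms, e a ↔ e' a) :
    f.propEval e ↔ f.propEval e' := by
  induction f with
  | obs b => exact h _ (List.mem_singleton_self _)
  | prob b c p => exact h _ (List.mem_singleton_self _)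
  | imp f g ihf ihg =>
    rw [propEval, propEval, ihf fun a ha => h a (List.mem_append_left _ ha),
      ihg fun a ha => h a (List.mem_append_right _ ha)]

theorem propEval_of_forall_atoms {f : PForm} (h : ∀ a ∈ f.atoms, e a) : f.propEval e := by
  induction f with
  | obs b => exact h _ (List.mem_singleton_self _)
  | prob b c p => exact h _ (List.mem_singleton_self _)
  | imp f g _ ihg => exact fun _ => ihg fun a ha => h a (List.mem_append_right _ ha)

theorem derivable_of_valid {f : PForm} (hf : Valid f) : Derivable f := by
  classical
  -- These clauses treat assignments that make the atom falsum true: they force all atoms of `f` to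
  -- be true, and then `f`, built with implication only, is true.
  let l₁ : List PForm := f.atoms.map fun a => clause [falsum] a
  -- All choices of a sign for each atom are listed, but only the refutable ones are kept. For an
  -- assignment that falsifies `f`, its own choice turns out to be among them.
  let l₂ : List PForm := ((f.atoms.map fun a => [a, neg a]).sections.map fun L =>
    clause L falsum).filter fun g => Derivable g
  have hfalsum : falsum.IsAtom := .prob _ _ _
  refine derivable_of_tautological_consequence (l := l₁ ++ l₂) (fun g hg => ?_) fun e he => ?_
  · rcases List.mem_append.1 hg with hg | hg
    · obtain ⟨a, ha, rfl⟩ := List.mem_map.1 hg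
      refine derivable_clause_of_valid (List.forall_mem_singleton.2 (Or.inl hfalsum))
        (Or.inl (isAtom_of_mem_atoms ha)) fun H _ _ _ _ I ρ => Or.inl (I.not_sat_falsum ρ)
    · simpa using (List.mem_filter.1 hg).2
  by_cases h0 : e falsum
  · refine propEval_of_forall_atoms fun a ha => ?_
    exact (isAtom_of_mem_atoms ha).propEval_iff.1
      (he _ (List.mem_append_left _ (List.mem_map_of_mem ha)) h0)
  by_contra hfe
  -- The literals that describe the assignment on the atoms of `f`. A structure satisfying all of
  -- them would falsify `f`, so their refutation is a valid clause.
  let L : List PForm := f.atoms.map fun a => if e a then a else neg a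
  have hL : ∀ e' : PForm → Prop, ¬ e' falsum →
      ((∀ g ∈ L, g.propEval e') ↔ ∀ a ∈ f.atoms, e' a ↔ e a) := by
    intro e' he'
    rw [List.forall_mem_map]
    refine forall₂_congr fun a ha => ?_
    have hat := isAtom_of_mem_atoms ha
    by_cases hea : e a
    · simp [hea, hat.propEval_iff]
    · simp [hea, propEval_neg he', hat.propEval_iff]
  have hder : Derivable (clause L falsum) := by
    refine derivable_clause_of_valid (fun g hg => ?_) (Or.inl hfalsum) fun H _ _ _ _ I ρ => ?_
    · obtain ⟨a, ha, rfl⟩ := List.mem_map.1 hg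
      split_ifs
      · exact Or.inl (isAtom_of_mem_atoms ha)
      · exact Or.inr ⟨a, isAtom_of_mem_atoms ha, rfl⟩
    · rw [I.sat_iff_propEval, propEval_clause (I.not_sat_falsum ρ), hL _ (I.not_sat_falsum ρ)]
      intro h
      exact absurd ((propEval_congr h).1 ((I.sat_iff_propEval ρ f).1 (hf H I ρ))) hfe
  have hmem : clause L falsum ∈ l₂ := by
    refine List.mem_filter.2 ⟨List.mem_map.2 ⟨L, List.mem_sections.2 ?_, rfl⟩, by simpa using hder⟩
    rw [List.forall₂_map_left_iff, List.forall₂_map_right_iff, List.forall₂_same]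
    intro a _
    split_ifs <;> simp
  have h1 := he _ (List.mem_append_right _ hmem)
  rw [propEval_clause h0, hL e h0] at h1
  exact h0 (h1 fun _ _ => Iff.rfl)

end PForm

end Propositional

end Completeness

end PLQO

theorem mainTheorem1 (φ : PLQO.PForm) (hφ : PLQO.Valid φ) : PLQO.PForm.Derivable φ :=
  PLQO.PForm.derivable_of_valid hφ
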